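/- All coefficients are in $\mathbb{Z}_2$. A *3D polyhedral complex* $X$ is a finite regular cell complex embedded in $\mathbb{R}^3$ whose closed cells are homeomorphic images of convex polytopes, the faces of a polytope corresponding to cells of $X$; $C_*(X)$ is its cellular chain complex, with basis the cells. A *diagonal approximation* on a regular cell complex $Y$ is a cellular map $\Delta\colon Y\to Y\times Y$ that is homotopic to the geometric diagonal $y\mapsto(y,y)$, satisfies $\Delta(\sigma)\subseteq\sigma\times\sigma$ for every cell $\sigma$ of $Y$, and induces a chain map (its coproduct) $\widetilde\Delta\colon C_*(Y)\to C_*(Y\times Y)\cong C_*(Y)\otimes C_*(Y)$. **Theorem.** Let $X$ be a 3D polyhedral complex. Number the vertices of $X$ arbitrarily from $1$ to $n$, and write a polygon ($2$-cell) $p$ of $X$ as the tuple $p=\langle i_1,\dots,i_k\rangle$ ($k\ge 3$) of the numbers of its vertices in cyclic order, where $i_1=\min\{i_1,\dots,i_k\}$, $i_j$ is adjacent to $i_{j+1}$ along an edge of $p$ for $1\le j<k$, and $i_k$ is adjacent to $i_1$. Let $u_2=\langle i_1,i_2\rangle$, $u_k=\langle i_1,i_k\rangle$ and $e_j=\langle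 i_j,i_{j+1}\rangle$ $(2\le j\le k-1)$ be the edges of $p$. Let $m=m(k)\in\{2,\dots,k\}$ be the position of the maximal vertex, $i_m=\max\{i_2,\dots,i_k\}$, and for $2\le j\le k-1$ let $\lambda_j\in\mathbb{Z}_2$ be $0$ if $i_j<i_{j+1}$ and $1$ otherwise. Then there is a diagonal approximation on $p$ (regarded as the cell complex consisting of $p$ and its faces) whose induced coproduct satisfies $$\widetilde\Delta_p(p)=\langle i_1\rangle\otimes p+p\otimes\langle i_m\rangle+\sum_{j=2}^{m-1}\bigl(u_2+e_2+\cdots+e_{j-1}+\lambda_je_j\bigr)\otimes e_j+\sum_{j=m}^{k-1}\bigl[(1+\lambda_j)e_j+e_{j+1}+\cdots+e_{k-1}+u_k\bigr]\otimes e_j .$$ -/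

import Mathlib

open scoped TensorProduct

noncomputable section

/-- A (finite) polyhedral complex embedded in `ℝ³`: a regular cell complex whose closed cells are
homeomorphic images in `ℝ³` of convex polytopes.  The image of every non-empty face of the polytope
of a cell is again a cell (of the same dimension as the face), and the open cells are pairwise
disjoint.  Cells are not required to be flat. -/
structure PolyhedralComplex3 where
  /-- the index set of the cells -/
  Cell : Type
  fintypeCell : Fintype Cell
  /-- the dimension of a cell -/
  dim : Cell → ℕ
  /-- the model polytope of a cell, a full-dimensional polytope in `ℝ^(dim c)` -/
  poly : ∀ c, Set (EuclideanSpace ℝ (Fin (dim c)))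
  isPolytope : ∀ c, ∃ s : Finset (EuclideanSpace ℝ (Fin (dim c))),
    poly c = convexHull ℝ (s : Set (EuclideanSpace ℝ (Fin (dim c))))
  interior_nonempty : ∀ c, (interior (poly c)).Nonempty
  /-- the characteristic map of a cell; only its values on `poly c` matter -/
  chart : ∀ c, EuclideanSpace ℝ (Fin (dim c)) → EuclideanSpace ℝ (Fin 3)
  chart_continuousOn : ∀ c, ContinuousOn (chart c) (poly c)
  chart_injOn : ∀ c, Set.InjOn (chart c) (poly c)
  disjoint_openCells : ∀ c d, c ≠ d →
    Disjoint (chart c '' interior (poly c)) (chart d '' interior (poly d))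
  exists_face : ∀ (c) (F : Set (EuclideanSpace ℝ (Fin (dim c)))), F.Nonempty →
    IsExposed ℝ (poly c) F →
    ∃ d, chart d '' poly d = chart c '' F ∧ dim d = Module.finrank ℝ (vectorSpan ℝ F)

namespace PolyhedralComplex3

attribute [instance] PolyhedralComplex3.fintypeCell

variable (X : PolyhedralComplex3)

/-- The closed cell with index `c`, as a subset of `ℝ³`. -/
def cell (c : X.Cell) : Set (EuclideanSpace ℝ (Fin 3)) := X.chart c '' X.poly c

/-- The open cell with index `c`, as a subset of `ℝ³`. -/
def openCell (c : X.Cell) : Set (EuclideanSpace ℝ (Fin 3)) := X.chart c '' interior (X.poly c)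

/-- The underlying space: the union of all the cells. -/
def space : Set (EuclideanSpace ℝ (Fin 3)) := ⋃ c, X.cell c

/-- A single closed cell together with all its faces, as a polyhedral complex. -/
def faceComplex (p : X.Cell) : PolyhedralComplex3 where
  Cell := {c : X.Cell // X.cell c ⊆ X.cell p}
  fintypeCell := Fintype.ofFinite _
  dim c := X.dim c.1
  poly c := X.poly c.1
  isPolytope c := X.isPolytope c.1
  interior_nonempty c := X.interior_nonempty c.1
  chart c := X.chart c.1
  chart_continuousOn c := X.chart_continuousOn c.1
  chart_injOn c := X.chart_injOn c.1
  disjoint_openCells c d h := X.disjoint_openCells c.1 d.1 (fun h1 => h (Subtype.ext h1))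
  exists_face c F hF hE := by
    obtain ⟨d, hd, hdim⟩ := X.exists_face c.1 F hF hE
    refine ⟨⟨d, ?_⟩, hd, hdim⟩
    refine subset_trans ?_ c.2
    unfold cell
    rw [hd]
    exact Set.image_mono hE.subset

/-- The cell `p`, as the top cell of the complex formed by `p` and its faces. -/
def topCell (p : X.Cell) : (X.faceComplex p).Cell := ⟨p, subset_rfl⟩

/-- The cellular chains `C_*(X)` with coefficients in `ℤ/2`, all degrees together: the vector space
with basis the cells. -/
abbrev Chains : Type := X.Cell →₀ ZMod 2

/-- The generator of `C_*(X)` given by a cell. -/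
def gen (c : X.Cell) : X.Chains := Finsupp.single c 1

/-- `d` is a codimension-one face of `c`. -/
def IsFacet (d c : X.Cell) : Prop := X.cell d ⊆ X.cell c ∧ X.dim d + 1 = X.dim c

open Classical in
/-- The cellular boundary mod 2: the boundary of a cell of a regular complex is the sum of its
facets. -/
def boundary : X.Chains →ₗ[ZMod 2] X.Chains :=
  Finsupp.linearCombination (ZMod 2)
    (fun c => ∑ d ∈ Finset.univ.filter (fun d => X.IsFacet d c), X.gen d)

/-- The boundary `∂ ⊗ 1 + 1 ⊗ ∂` of `C_*(X) ⊗ C_*(X)`, that is, of `C_*(X × X)`. -/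
def boundaryTensor : (X.Chains ⊗[ZMod 2] X.Chains) →ₗ[ZMod 2] (X.Chains ⊗[ZMod 2] X.Chains) :=
  TensorProduct.map X.boundary LinearMap.id + TensorProduct.map LinearMap.id X.boundary

/-- The coefficient of the product cell `a × b`, that is, of the basis vector `a ⊗ b`. -/
def coeff (z : X.Chains ⊗[ZMod 2] X.Chains) (a b : X.Cell) : ZMod 2 :=
  finsuppTensorFinsupp' (ZMod 2) X.Cell X.Cell z (a, b)

/-- The open product cell in `X × X`. -/
def openProdCell (a b : X.Cell) : Set (X.space × X.space) :=
  {y | (y.1 : EuclideanSpace ℝ (Fin 3)) ∈ X.openCell a ∧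
    (y.2 : EuclideanSpace ℝ (Fin 3)) ∈ X.openCell b}

/-- The mod 2 degree with which `f : X → X × X` maps the cell `σ` over the product cell `a × b` of
the same dimension is `r`: over some non-empty relatively open part of the open cell `a × b`, the
part of `σ` lying above it is the disjoint union of `N` sheets, each mapped homeomorphically (the
sheets are the images of `N` continuous, pairwise disjoint sections), and `r` is `N` mod 2.
For a cellular map `f` this is the coefficient of `a × b` in the cellular chain `f_*(σ)`. -/
def HasDegreeModTwo (f : C(X.space, X.space × X.space)) (σ a b : X.Cell) (r : ZMod 2) : Prop :=
  ∃ O : Set (X.space × X.space), IsOpen O ∧ (O ∩ X.openProdCell a b).Nonempty ∧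
    ∃ (N : ℕ) (s : Fin N → C(↥(O ∩ X.openProdCell a b),
        {x : X.space // (x : EuclideanSpace ℝ (Fin 3)) ∈ X.cell σ})),
      (∀ i y, f (s i y).1 = y.1) ∧
      (∀ y, Function.Injective (fun i => s i y)) ∧
      (∀ x : {x : X.space // (x : EuclideanSpace ℝ (Fin 3)) ∈ X.cell σ},
        f x.1 ∈ O ∩ X.openProdCell a b → ∃ i y, s i y = x) ∧
      (N : ZMod 2) = r

/-- The linear map `D : C_*(X) → C_*(X) ⊗ C_*(X)` is the map of cellular chains induced by the
(cellular) map `f : X → X × X`: it preserves degrees, and its coefficients are the mod 2 degrees of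
`f` on cells. -/
def IsInducedBy (f : C(X.space, X.space × X.space))
    (D : X.Chains →ₗ[ZMod 2] X.Chains ⊗[ZMod 2] X.Chains) : Prop :=
  ∀ σ a b : X.Cell,
    (X.dim a + X.dim b = X.dim σ → X.HasDegreeModTwo f σ a b (X.coeff (D (X.gen σ)) a b)) ∧
    (X.dim a + X.dim b ≠ X.dim σ → X.coeff (D (X.gen σ)) a b = 0)

/-- The continuous map `f : X → X × X` is a diagonal approximation on `X`, with induced coproduct
`D`. -/
structure IsDiagonalApproximation (f : C(X.space, X.space × X.space))
    (D : X.Chains →ₗ[ZMod 2] X.Chains ⊗[ZMod 2] X.Chains) : Prop where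
  /-- `f` maps the `q`-skeleton of `X` into the `q`-skeleton of `X × X` -/
  cellular : ∀ (σ : X.Cell) (x : X.space), (x : EuclideanSpace ℝ (Fin 3)) ∈ X.cell σ →
    ∃ a b : X.Cell, X.dim a + X.dim b ≤ X.dim σ ∧
      ((f x).1 : EuclideanSpace ℝ (Fin 3)) ∈ X.cell a ∧
      ((f x).2 : EuclideanSpace ℝ (Fin 3)) ∈ X.cell b
  /-- `f` is homotopic to the geometric diagonal -/
  homotopic : f.Homotopic ((ContinuousMap.id X.space).prodMk (ContinuousMap.id X.space))
  /-- `f` maps `σ` into `σ × σ` -/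
  carried : ∀ (σ : X.Cell) (x : X.space), (x : EuclideanSpace ℝ (Fin 3)) ∈ X.cell σ →
    ((f x).1 : EuclideanSpace ℝ (Fin 3)) ∈ X.cell σ ∧
    ((f x).2 : EuclideanSpace ℝ (Fin 3)) ∈ X.cell σ
  /-- `D` is the map induced by `f` on cellular chains -/
  induced : X.IsInducedBy f D
  /-- `D` is a chain map -/
  chainMap : X.boundaryTensor ∘ₗ D = D ∘ₗ X.boundary

/-- A polygon (here `X` is the complex formed by the polygon and its faces) is written as the
`k`-tuple `⟨v 1, …, v k⟩` of its vertices in cyclic order: `v 1, …, v k` are its vertices and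
`e 1, …, e k` its edges, without repetition; for `j < k` the edge `e j` joins `v j` to `v (j + 1)`,
and `e k` joins `v k` to `v 1`. Values outside `1, …, k` are irrelevant. -/
structure IsCyclicTuple (k : ℕ) (v e : ℕ → X.Cell) : Prop where
  three_le : 3 ≤ k
  vertices : Set.BijOn v (Set.Icc 1 k) {c | X.dim c = 0}
  edges : Set.BijOn e (Set.Icc 1 k) {c | X.dim c = 1}
  ends : ∀ j, 1 ≤ j → j < k → {c | X.IsFacet c (e j)} = {v j, v (j + 1)}
  ends_last : {c | X.IsFacet c (e k)} = {v k, v 1}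

end PolyhedralComplex3

end

/-! The first vertex and the vertex `v m` cut the boundary of the polygon into two arcs, so the
polygon is a bigon (`IsBigon`). It carries coordinates `(x, t)` in `[0, 1] × [-1, 1]` with `x = 0`
and `x = 1` collapsed to the two marked vertices and `t = ±1` on the two sides
(`exists_isCoordinate`). In these coordinates the diagonal map sends `(x, t)` to the pair of points
with first coordinates `x - h` and `x + h`, both at height `2t` clamped to `[-1, 1]`.

In the middle band `|t| ≤ 1/2` one takes `h = min x (1 - x)`. The left half of the band then covers
(initial vertex) × polygon once, and the right half covers polygon × (final vertex) once: these are
the two primitive terms. In the two outer strips both points lie on one side, and `h` moves linearly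
from `min x (1 - x)` to a function `tentSum` with a tent over each edge, upright or inverted
according to the orientation of the edge. On the boundary this gives each edge the coproduct (low
end) ⊗ edge + edge ⊗ (high end). Inside a strip, a pair `(α, β)` interior to two edges is attained
exactly when its half-difference exceeds the tent at its midpoint, and then once. For edges `i`, `j`
of the side this happens if `i < j`, or if `i = j` and the tent is inverted (`hasDegree_top_edges`,
`eq_and_of_mem_edges`). Summing over `i` gives the left factors of the formula.

All degrees are thus 0 or 1 (`isInducedBy`). The homotopy to the diagonal exists because a disc is
contractible, and the chain map identity is summation by parts along each side
(`chainMap_of_coproduct`). Orienting edges by increasing vertex number turns the bigon coproduct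
into the stated one. -/

namespace PolyhedralComplex3

/-! ### Cells of dimension one and two as arcs and discs -/

section Cells

variable (Y : PolyhedralComplex3)

lemma convex_poly (c : Y.Cell) : Convex ℝ (Y.poly c) := by
  obtain ⟨s, hs⟩ := Y.isPolytope c
  rw [hs]
  exact convex_convexHull ℝ (s : Set (EuclideanSpace ℝ (Fin (Y.dim c))))

lemma isCompact_poly (c : Y.Cell) : IsCompact (Y.poly c) := by
  obtain ⟨s, hs⟩ := Y.isPolytope c
  rw [hs]
  exact s.finite_toSet.isCompact_convexHull (𝕜 := ℝ)

lemma isCompact_cell (c : Y.Cell) : IsCompact (Y.cell c) :=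
  (Y.isCompact_poly c).image_of_continuousOn (Y.chart_continuousOn c)

lemma openCell_subset_cell (c : Y.Cell) : Y.openCell c ⊆ Y.cell c :=
  Set.image_mono interior_subset

lemma openCell_nonempty (c : Y.Cell) : (Y.openCell c).Nonempty :=
  (Y.interior_nonempty c).image _

variable {Y}

lemma eq_of_mem_openCell {c d : Y.Cell} {y : EuclideanSpace ℝ (Fin 3)}
    (hc : y ∈ Y.openCell c) (hd : y ∈ Y.openCell d) : c = d := by
  by_contra h
  exact Set.disjoint_left.1 (Y.disjoint_openCells c d h) hc hd

lemma eq_univ_of_dim_zero {c : Y.Cell} (hc : Y.dim c = 0)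
    {s : Set (EuclideanSpace ℝ (Fin (Y.dim c)))} (hs : s.Nonempty) : s = Set.univ := by
  have : IsEmpty (Fin (Y.dim c)) := by rw [hc]; infer_instance
  have : Subsingleton (EuclideanSpace ℝ (Fin (Y.dim c))) :=
    ⟨fun x y => by ext i; exact isEmptyElim i⟩
  exact Subsingleton.eq_univ_of_nonempty hs

lemma openCell_eq_cell {c : Y.Cell} (hc : Y.dim c = 0) : Y.openCell c = Y.cell c := by
  have h := Y.interior_nonempty c
  unfold openCell cell
  rw [eq_univ_of_dim_zero hc h, eq_univ_of_dim_zero hc (h.mono interior_subset)]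

lemma exists_cell_eq_singleton {c : Y.Cell} (hc : Y.dim c = 0) : ∃ y, Y.cell c = {y} := by
  obtain ⟨x, hx⟩ := (Y.interior_nonempty c).mono interior_subset
  have : IsEmpty (Fin (Y.dim c)) := by rw [hc]; infer_instance
  refine ⟨Y.chart c x, ?_⟩
  unfold cell
  rw [← Set.image_singleton]
  congr 1
  ext y
  constructor
  · intro _
    ext i
    exact isEmptyElim i
  · rintro rfl
    exact hx

lemma exists_dim_zero_cell {c : Y.Cell} {x : EuclideanSpace ℝ (Fin (Y.dim c))}
    (hx : IsExposed ℝ (Y.poly c) {x}) : ∃ d, Y.dim d = 0 ∧ Y.cell d = {Y.chart c x} := by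
  obtain ⟨d, hd, hdim⟩ := Y.exists_face c {x} (Set.singleton_nonempty x) hx
  refine ⟨d, ?_, ?_⟩
  · rw [hdim, vectorSpan_singleton]
    simp
  · unfold cell
    rw [hd, Set.image_singleton]

/-- A `1`-cell is an arc: it is parametrized by the unit interval, and its end points are
`0`-cells. -/
lemma exists_arc {c : Y.Cell} (hc : Y.dim c = 1) :
    ∃ ε : ℝ → EuclideanSpace ℝ (Fin 3), ContinuousOn ε (Set.Icc 0 1) ∧
      Set.InjOn ε (Set.Icc 0 1) ∧ ε '' Set.Icc 0 1 = Y.cell c ∧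
      ε '' Set.Ioo 0 1 = Y.openCell c ∧
      ∃ a b, Y.dim a = 0 ∧ Y.dim b = 0 ∧ Y.cell a = {ε 0} ∧ Y.cell b = {ε 1} := by
  -- A linear isomorphism with `ℝ` turns the model polytope into a compact convex set with interior
  -- points, hence a nondegenerate interval.
  have hfr : Module.finrank ℝ ℝ =
      Module.finrank ℝ (EuclideanSpace ℝ (Fin (Y.dim c))) := by simp [hc]
  let ψ : ℝ ≃L[ℝ] EuclideanSpace ℝ (Fin (Y.dim c)) := ContinuousLinearEquiv.ofFinrankEq hfr
  have hne : (interior (ψ ⁻¹' Y.poly c)).Nonempty := by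
    have := ψ.toHomeomorph.preimage_interior (Y.poly c)
    simp only [ContinuousLinearEquiv.coe_toHomeomorph] at this
    rw [← this]
    exact (Y.interior_nonempty c).preimage ψ.surjective
  have hcomp : IsCompact (ψ ⁻¹' Y.poly c) :=
    ψ.toHomeomorph.isCompact_preimage.2 (Y.isCompact_poly c)
  have hconv : Convex ℝ (ψ ⁻¹' Y.poly c) :=
    (Y.convex_poly c).linear_preimage ψ.toLinearEquiv.toLinearMap
  obtain ⟨A, B, hAB⟩ : ∃ A B, ψ ⁻¹' Y.poly c = Set.Icc A B :=
    ⟨_, _, eq_Icc_of_connected_compact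
      (hconv.isConnected (hne.mono interior_subset)) hcomp⟩
  rw [hAB, interior_Icc, Set.nonempty_Ioo] at hne
  have hpoly : Y.poly c = ψ '' Set.Icc A B := by
    rw [← hAB, Set.image_preimage_eq _ ψ.surjective]
  have hint : interior (Y.poly c) = ψ '' Set.Ioo A B := by
    rw [hpoly, ← interior_Icc]
    exact (ψ.toHomeomorph.image_interior _).symm
  let τ : ℝ → ℝ := fun s => A + s * (B - A)
  have hBA : 0 < B - A := sub_pos.2 hne
  have hτI : τ '' Set.Icc 0 1 = Set.Icc A B := by
    ext y
    constructor
    · rintro ⟨s, ⟨h0, h1⟩, rfl⟩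
      constructor <;> simp only [τ] <;> nlinarith
    · rintro ⟨h0, h1⟩
      refine ⟨(y - A) / (B - A), ⟨div_nonneg (by linarith) hBA.le, ?_⟩, ?_⟩
      · rw [div_le_one hBA]; linarith
      · simp only [τ]; field_simp; ring
  have hτO : τ '' Set.Ioo 0 1 = Set.Ioo A B := by
    ext y
    constructor
    · rintro ⟨s, ⟨h0, h1⟩, rfl⟩
      constructor <;> simp only [τ] <;> nlinarith
    · rintro ⟨h0, h1⟩
      refine ⟨(y - A) / (B - A), ⟨div_pos (by linarith) hBA, ?_⟩, ?_⟩
      · rw [div_lt_one hBA]; linarith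
      · simp only [τ]; field_simp; ring
  have hmaps : Set.MapsTo (fun s => ψ (τ s)) (Set.Icc 0 1) (Y.poly c) := by
    intro s hs
    rw [hpoly]
    exact ⟨τ s, hτI ▸ ⟨s, hs, rfl⟩, rfl⟩
  -- An end point of the interval is the strict maximum of plus or minus the coordinate, so it is an
  -- exposed face and comes with a `0`-cell.
  have hexp : ∀ x ∈ Set.Icc A B, (∃ r : ℝ, ∀ y ∈ Set.Icc A B, r * y ≤ r * x ∧
      (r * x ≤ r * y → y = x)) → IsExposed ℝ (Y.poly c) {ψ x} := by
    rintro x hx ⟨r, hr⟩ -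
    refine ⟨r • (ψ.symm : EuclideanSpace ℝ (Fin (Y.dim c)) →L[ℝ] ℝ), ?_⟩
    rw [hpoly]
    ext z
    simp only [Set.mem_singleton_iff, Set.mem_ofPred_eq, Set.mem_image]
    constructor
    · rintro rfl
      refine ⟨⟨x, hx, rfl⟩, ?_⟩
      rintro _ ⟨y, hy, rfl⟩
      simpa using (hr y hy).1
    · rintro ⟨⟨y, hy, rfl⟩, h⟩
      have := h (ψ x) ⟨x, hx, rfl⟩
      rw [(hr y hy).2 (by simpa using this)]
  refine ⟨fun s => Y.chart c (ψ (τ s)), ?_, ?_, ?_, ?_, ?_⟩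
  · refine (Y.chart_continuousOn c).comp ?_ hmaps
    exact (ψ.continuous.comp (by fun_prop)).continuousOn
  · intro s hs t ht h
    have := ψ.injective (Y.chart_injOn c (hmaps hs) (hmaps ht) h)
    simp only [τ] at this
    have h2 : (s - t) * (B - A) = 0 := by linarith
    rcases mul_eq_zero.1 h2 with h3 | h3 <;> linarith
  · unfold cell
    rw [hpoly, ← hτI, Set.image_image, Set.image_image]
  · unfold openCell
    rw [hint, ← hτO, Set.image_image, Set.image_image]
  · obtain ⟨a, ha, ha'⟩ := Y.exists_dim_zero_cell (hexp A ⟨le_rfl, hne.le⟩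
      ⟨-1, fun y hy => ⟨by linarith [hy.1], fun h => by linarith [hy.1]⟩⟩)
    obtain ⟨b, hb, hb'⟩ := Y.exists_dim_zero_cell (hexp B ⟨hne.le, le_rfl⟩
      ⟨1, fun y hy => ⟨by linarith [hy.2], fun h => by linarith [hy.2]⟩⟩)
    refine ⟨a, b, ha, hb, ?_, ?_⟩
    · simpa [τ] using ha'
    · simpa [τ] using hb'

/-- Every point of a `2`-cell outside the open cell lies in an open cell of smaller dimension. -/
lemma exists_openCell_of_notMem_interior {T : Y.Cell} (hT : Y.dim T = 2)
    {y : EuclideanSpace ℝ (Fin 3)} (hy : y ∈ Y.cell T) (hyT : y ∉ Y.openCell T) :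
    ∃ d, Y.dim d < 2 ∧ y ∈ Y.openCell d := by
  obtain ⟨z, hz, rfl⟩ := hy
  have hzi : z ∉ interior (Y.poly T) := fun h => hyT ⟨z, h, rfl⟩
  obtain ⟨f, hf⟩ := geometric_hahn_banach_open_point (Y.convex_poly T).interior
    isOpen_interior hzi
  obtain ⟨a, ha⟩ := Y.interior_nonempty T
  have hle : ∀ x ∈ Y.poly T, f x ≤ f z := by
    intro x hx
    have hcl : x ∈ closure (interior (Y.poly T)) := by
      rw [(Y.convex_poly T).closure_interior_eq_closure_of_nonempty_interior ⟨a, ha⟩]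
      exact subset_closure hx
    exact closure_minimal (t := {x | f x ≤ f z}) (fun x hx => (hf x hx).le)
      (isClosed_le f.continuous continuous_const) hcl
  -- The exposed face cut out by the supporting functional at the boundary point. The functional is
  -- nonzero but constant on `F`, so `F` spans a proper subspace and its cell has dimension at most
  -- one.
  let F := {x ∈ Y.poly T | ∀ y ∈ Y.poly T, f y ≤ f x}
  have hzF : z ∈ F := ⟨hz, hle⟩
  obtain ⟨d, hd, hdim⟩ := Y.exists_face T F ⟨z, hzF⟩ (fun _ => ⟨f, rfl⟩)
  have hker : vectorSpan ℝ F ≤ LinearMap.ker f.toLinearMap := by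
    rw [vectorSpan_def, Submodule.span_le]
    rintro _ ⟨x, hx, y, hy, rfl⟩
    have h1 := hx.2 y hy.1
    have h2 := hy.2 x hx.1
    have : f x = f y := le_antisymm h2 h1
    simp [this]
  have hlt : vectorSpan ℝ F < ⊤ := by
    refine lt_of_le_of_lt hker (lt_top_iff_ne_top.2 fun h => ?_)
    have h0 : f.toLinearMap = 0 := LinearMap.ker_eq_top.1 h
    have h1 := hf a ha
    have h2 : ∀ x, f x = 0 := fun x => by
      have := LinearMap.congr_fun h0 x
      simpa using this
    rw [h2, h2] at h1
    exact lt_irrefl _ h1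
  have hdlt : Y.dim d < 2 := by
    rw [hdim]
    have := Submodule.finrank_lt hlt.ne
    simpa [hT] using this
  have hyd : Y.chart T z ∈ Y.cell d := by
    unfold cell
    rw [hd]
    exact ⟨z, hzF, rfl⟩
  obtain hn | hn : Y.dim d = 0 ∨ Y.dim d = 1 := by omega
  · exact ⟨d, by omega, by rwa [openCell_eq_cell hn]⟩
  · obtain ⟨ε, -, -, hε, hε', p, q, hp, hq, hp', hq'⟩ := exists_arc hn
    rw [← hε] at hyd
    obtain ⟨s, ⟨hs0, hs1⟩, hs⟩ := hyd
    rcases hs0.eq_or_lt with rfl | hs0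
    · exact ⟨p, by omega, by rw [openCell_eq_cell hp, hp', ← hs]; rfl⟩
    rcases hs1.eq_or_lt with rfl | hs1
    · exact ⟨q, by omega, by rw [openCell_eq_cell hq, hq', ← hs]; rfl⟩
    · refine ⟨d, by omega, ?_⟩
      rw [← hε', ← hs]
      exact ⟨s, ⟨hs0, hs1⟩, rfl⟩

/-- A point of the open cell `c` is outside the open cell `T`, so it lies in an open cell of
dimension below two; disjointness of open cells forces that cell to be `c`. -/
lemma dim_lt_two {T : Y.Cell} (hT : Y.dim T = 2) (htop : ∀ c, Y.cell c ⊆ Y.cell T)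
    {c : Y.Cell} (hc : c ≠ T) : Y.dim c < 2 := by
  obtain ⟨y, hy⟩ := Y.openCell_nonempty c
  by_cases h : y ∈ Y.openCell T
  · exact absurd (eq_of_mem_openCell hy h) hc
  · obtain ⟨d, hd, hyd⟩ :=
      exists_openCell_of_notMem_interior hT (htop c (Y.openCell_subset_cell c hy)) h
    rwa [eq_of_mem_openCell hy hyd]

/-- A `2`-cell is a disc: it is parametrized by a closed ball, the interior of the ball
corresponding to the open cell. -/
lemma exists_homeomorph_closedBall {T : Y.Cell} (htop : ∀ c, Y.cell c ⊆ Y.cell T) :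
    ∃ e : Metric.closedBall (0 : EuclideanSpace ℝ (Fin (Y.dim T))) 1 ≃ₜ Y.space,
      ∀ w, ((e w : Y.space) : EuclideanSpace ℝ (Fin 3)) ∈ Y.openCell T ↔ ‖(w : EuclideanSpace ℝ (Fin (Y.dim T)))‖ < 1 := by
  obtain ⟨h, hi, hc, -⟩ := exists_homeomorph_image_interior_closure_frontier_eq_unitBall
    (Y.convex_poly T) (Y.interior_nonempty T)
    (Y.isCompact_poly T).isBounded
  rw [(Y.isCompact_poly T).isClosed.closure_eq] at hc
  have hmem : ∀ w : Metric.closedBall (0 : EuclideanSpace ℝ (Fin (Y.dim T))) 1,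
      h.symm w ∈ Y.poly T := by
    rintro ⟨w, hw⟩
    rw [← hc] at hw
    obtain ⟨z, hz, rfl⟩ := hw
    simpa using hz
  have hspace : Y.space = Y.cell T :=
    subset_antisymm (Set.iUnion_subset htop) (Set.subset_iUnion _ T)
  let g : Metric.closedBall (0 : EuclideanSpace ℝ (Fin (Y.dim T))) 1 → Y.space :=
    fun w => ⟨Y.chart T (h.symm w), by rw [hspace]; exact ⟨_, hmem w, rfl⟩⟩
  have hg : Continuous g := by
    refine Continuous.subtype_mk ?_ _
    exact (Y.chart_continuousOn T).comp_continuous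
      (h.symm.continuous.comp continuous_subtype_val) hmem
  have hbij : Function.Bijective g := by
    constructor
    · intro w w' hww
      have := Y.chart_injOn T (hmem w) (hmem w') (congrArg Subtype.val hww)
      exact Subtype.ext (h.symm.injective this)
    · rintro ⟨y, hy⟩
      rw [hspace] at hy
      obtain ⟨z, hz, rfl⟩ := hy
      refine ⟨⟨h z, hc ▸ ⟨z, hz, rfl⟩⟩, ?_⟩
      simp [g]
  have : CompactSpace (Metric.closedBall (0 : EuclideanSpace ℝ (Fin (Y.dim T))) 1) :=
    isCompact_iff_compactSpace.1 (isCompact_closedBall _ _)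
  refine ⟨hg.homeoOfEquivCompactToT2 (f := Equiv.ofBijective g hbij), fun w => ?_⟩
  change Y.chart T (h.symm w) ∈ Y.openCell T ↔ _
  rw [← mem_ball_zero_iff, ← hi]
  constructor
  · rintro ⟨z, hz, hzw⟩
    have := Y.chart_injOn T (interior_subset hz) (hmem w) hzw
    exact ⟨z, hz, by simp [this]⟩
  · rintro ⟨z, hz, hzw⟩
    refine ⟨z, hz, ?_⟩
    rw [← hzw]
    simp

end Cells

end PolyhedralComplex3

/-! ### Concatenation of paths and radial extension -/

lemma exists_continuous_concat {S : Type*} [TopologicalSpace S] (ε : ℕ → ℝ → S) (n : ℕ)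
    (hc : ∀ i ≤ n, Continuous (ε i)) (hε : ∀ i < n, ε i 1 = ε (i + 1) 0) :
    ∃ P : ℝ → S, Continuous P ∧ ∀ i ≤ n, ∀ u ∈ Set.Icc (0 : ℝ) 1, P (i + u) = ε i u := by
  induction n with
  | zero =>
    refine ⟨ε 0, hc 0 le_rfl, fun i hi u _ => ?_⟩
    obtain rfl : i = 0 := by omega
    simp
  | succ n ih =>
    obtain ⟨P, hP, hPε⟩ := ih (fun i hi => hc i (by omega)) (fun i hi => hε i (by omega))
    have hend : P (n + 1) = ε (n + 1) 0 := by
      rw [hPε n le_rfl 1 (by simp), hε n (by omega)]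
    refine ⟨fun s => if s ≤ n + 1 then P s else ε (n + 1) (s - (n + 1)), ?_, ?_⟩
    · refine Continuous.if_le hP ((hc (n + 1) le_rfl).comp (by fun_prop)) continuous_id
        continuous_const ?_
      rintro s rfl
      simpa using hend
    · rintro i hi u ⟨hu0, hu1⟩
      rcases Nat.lt_or_ge n i with h | h
      · obtain rfl : i = n + 1 := by omega
        push_cast
        rcases hu0.eq_or_lt with rfl | hu0
        · simpa using hend
        · rw [if_neg (by linarith)]
          congr 1
          ring
      · have hi' : (i : ℝ) ≤ n := by exact_mod_cast h
        simp only
        rw [if_pos (by linarith), hPε i h u ⟨hu0, hu1⟩]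

/-- The radial extension of a bijection of unit spheres. -/
lemma exists_radial_extension {E : Type*} [NormedAddCommGroup E] [NormedSpace ℝ E] (φ : ℂ → E)
    (hc : ContinuousOn φ (Metric.sphere 0 1)) (hn : ∀ z, ‖z‖ = 1 → ‖φ z‖ = 1)
    (hinj : ∀ z z', ‖z‖ = 1 → ‖z'‖ = 1 → φ z = φ z' → z = z')
    (hsurj : ∀ w, ‖w‖ = 1 → ∃ z, ‖z‖ = 1 ∧ φ z = w) :
    ∃ R : ℂ → E, Continuous R ∧ (∀ z, ‖R z‖ = ‖z‖) ∧ Function.Injective R ∧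
      Function.Surjective R ∧ ∀ z, ‖z‖ = 1 → R z = φ z := by
  -- The direction of `z`. At the origin it takes the default value `0`, which is harmless because
  -- `φ (d z)` is scaled by `‖z‖`.
  let d : ℂ → ℂ := fun z => (‖z‖⁻¹ : ℝ) • z
  have hd : ∀ z, z ≠ 0 → ‖d z‖ = 1 := fun z hz => by
    simp [d, inv_mul_cancel₀ (norm_ne_zero_iff.2 hz)]
  have hzd : ∀ z, z = ‖z‖ • d z := fun z => by
    by_cases hz : z = 0
    · simp [hz]
    · simp only [d]
      rw [smul_smul, mul_inv_cancel₀ (norm_ne_zero_iff.2 hz), one_smul]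
  have hnorm : ∀ z, ‖‖z‖ • φ (d z)‖ = ‖z‖ := fun z => by
    by_cases hz : z = 0
    · simp [hz]
    · rw [norm_smul, hn _ (hd z hz)]
      simp
  refine ⟨fun z => ‖z‖ • φ (d z), ?_, hnorm, ?_, ?_, ?_⟩
  · rw [continuous_iff_continuousAt]
    intro z
    by_cases hz : z = 0
    · subst hz
      rw [ContinuousAt, norm_zero, zero_smul]
      refine squeeze_zero_norm (a := fun z => ‖z‖) (fun z => (hnorm z).le) ?_
      simpa using (continuous_norm (E := ℂ)).tendsto 0
    · have hdc : ContinuousOn d {0}ᶜ := by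
        intro w hw
        have hw : ‖w‖ ≠ 0 := norm_ne_zero_iff.2 hw
        have : ContinuousAt d w := by
          simp only [d]
          exact (continuous_norm.continuousAt.inv₀ hw).smul continuousAt_id
        exact this.continuousWithinAt
      have hon : ContinuousOn (fun z : ℂ => ‖z‖ • φ (d z)) {0}ᶜ :=
        continuous_norm.continuousOn.smul
          (hc.comp hdc (fun w hw => by simpa using hd w hw))
      exact hon.continuousAt (isOpen_compl_singleton.mem_nhds hz)
  · intro z z' h
    have h1 : ‖z‖ = ‖z'‖ := by
      rw [← hnorm z, ← hnorm z']
      exact congrArg _ h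
    by_cases hz : z = 0
    · rw [hz, norm_zero] at h1
      rw [hz, norm_eq_zero.1 h1.symm]
    · have hz' : z' ≠ 0 := fun h0 => hz (by rw [h0, norm_zero] at h1; exact norm_eq_zero.1 h1)
      simp only at h
      rw [h1] at h
      have h2 := smul_right_injective E (norm_ne_zero_iff.2 hz') h
      rw [hzd z, hzd z', h1, hinj _ _ (hd z hz) (hd z' hz') h2]
  · intro w
    by_cases hw : w = 0
    · exact ⟨0, by simp [hw]⟩
    · obtain ⟨z, hz, hzw⟩ := hsurj (‖w‖⁻¹ • w) (by
        rw [norm_smul, norm_inv, norm_norm, inv_mul_cancel₀ (norm_ne_zero_iff.2 hw)])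
      refine ⟨‖w‖ • z, ?_⟩
      have h1 : ‖‖w‖ • z‖ = ‖w‖ := by rw [norm_smul, hz]; simp
      have h2 : d (‖w‖ • z) = z := by
        simp only [d]
        rw [h1, smul_smul, inv_mul_cancel₀ (norm_ne_zero_iff.2 hw), one_smul]
      simp only
      rw [h1, h2, hzw, smul_smul, mul_inv_cancel₀ (norm_ne_zero_iff.2 hw), one_smul]
  · intro z hz
    simp [d, hz]

namespace PolyhedralComplex3

/-! ### Bigons and the parametrization of their sides -/

section Bigon

variable {Y : PolyhedralComplex3}

/-- The sign `1` or `-1` marking the two sides of a bigon. -/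
noncomputable def sgn (s : Bool) : ℝ := if s then 1 else -1

/-- The complex `Y` is a polygon `T` with its faces, and its boundary is split into two chains
of edges with the same end points: on side `s` there are the vertices `w s 0, …, w s (N s)` and the
edges `c s 0, …, c s (N s - 1)`. -/
structure IsBigon (T : Y.Cell) (N : Bool → ℕ) (w c : Bool → ℕ → Y.Cell) : Prop where
  dim_top : Y.dim T = 2
  subset_top : ∀ x, Y.cell x ⊆ Y.cell T
  pos : ∀ s, 0 < N s
  dim_w : ∀ s i, i ≤ N s → Y.dim (w s i) = 0
  dim_c : ∀ s i, i < N s → Y.dim (c s i) = 1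
  w_zero : ∀ s s', w s 0 = w s' 0
  w_last : ∀ s s', w s (N s) = w s' (N s')
  w_inj : ∀ s s' i j, i ≤ N s → j ≤ N s' → w s i = w s' j →
    s = s' ∧ i = j ∨ i = 0 ∧ j = 0 ∨ i = N s ∧ j = N s'
  c_inj : ∀ s s' i j, i < N s → j < N s' → c s i = c s' j → s = s' ∧ i = j
  exists_w : ∀ x, Y.dim x = 0 → ∃ s i, i ≤ N s ∧ x = w s i
  exists_c : ∀ x, Y.dim x = 1 → ∃ s i, i < N s ∧ x = c s i
  facets : ∀ s i, i < N s → {x | Y.IsFacet x (c s i)} = {w s i, w s (i + 1)}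

/-- `G` describes the polygon `T` by coordinates `(x, t) ∈ [0, 1] × [-1, 1]`, the segments
`x = 0` and `x = 1` being collapsed to points; the sides are `t = 1` and `t = -1`, with the
vertices at `x = b s i`. -/
structure IsCoordinate (T : Y.Cell) (N : Bool → ℕ) (w c : Bool → ℕ → Y.Cell)
    (b : Bool → ℕ → ℝ) (G : ℝ × ℝ → Y.space) : Prop where
  continuous : Continuous G
  surj : ∀ y, ∃ x ∈ Set.Icc (0 : ℝ) 1, ∃ t ∈ Set.Icc (-1 : ℝ) 1, G (x, t) = y
  inj : ∀ x ∈ Set.Icc (0 : ℝ) 1, ∀ x' ∈ Set.Icc (0 : ℝ) 1, ∀ t ∈ Set.Icc (-1 : ℝ) 1,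
    ∀ t' ∈ Set.Icc (-1 : ℝ) 1, G (x, t) = G (x', t') → x = x' ∧ (x = 0 ∨ x = 1 ∨ t = t')
  left : ∀ t t', G (0, t) = G (0, t')
  right : ∀ t t', G (1, t) = G (1, t')
  mem_top : ∀ x ∈ Set.Icc (0 : ℝ) 1, ∀ t ∈ Set.Icc (-1 : ℝ) 1,
    ((G (x, t) : EuclideanSpace ℝ (Fin 3)) ∈ Y.openCell T ↔ (0 < x ∧ x < 1) ∧ -1 < t ∧ t < 1)
  b_zero : ∀ s, b s 0 = 0
  b_last : ∀ s, b s (N s) = 1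
  b_lt : ∀ s i, i < N s → b s i < b s (i + 1)
  mem_w : ∀ s i, i ≤ N s → (G (b s i, sgn s) : EuclideanSpace ℝ (Fin 3)) ∈ Y.cell (w s i)
  mem_c : ∀ s i, i < N s → ∀ x, b s i ≤ x → x ≤ b s (i + 1) →
    (G (x, sgn s) : EuclideanSpace ℝ (Fin 3)) ∈ Y.cell (c s i)
  mem_openCell_c : ∀ s i, i < N s → ∀ x, b s i < x → x < b s (i + 1) →
    (G (x, sgn s) : EuclideanSpace ℝ (Fin 3)) ∈ Y.openCell (c s i)
  exists_of_mem_c : ∀ s i, i < N s → ∀ y : Y.space,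
    (y : EuclideanSpace ℝ (Fin 3)) ∈ Y.cell (c s i) →
      ∃ x, b s i ≤ x ∧ x ≤ b s (i + 1) ∧ G (x, sgn s) = y

/-- The facets form an unordered pair, whereas the arc must run from `a` to `b`; this version fixes
the direction so that consecutive edges can be concatenated. -/
lemma exists_arc_of_facets {a b c : Y.Cell} (hc : Y.dim c = 1)
    (hf : {x | Y.IsFacet x c} = {a, b}) :
    ∃ ε : ℝ → Y.space, Continuous ε ∧ Set.InjOn ε (Set.Icc 0 1) ∧
      (∀ u ∈ Set.Icc (0 : ℝ) 1, (ε u : EuclideanSpace ℝ (Fin 3)) ∈ Y.cell c) ∧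
      (∀ u ∈ Set.Ioo (0 : ℝ) 1, (ε u : EuclideanSpace ℝ (Fin 3)) ∈ Y.openCell c) ∧
      (∀ y : Y.space, (y : EuclideanSpace ℝ (Fin 3)) ∈ Y.cell c →
        ∃ u ∈ Set.Icc (0 : ℝ) 1, ε u = y) ∧
      (ε 0 : EuclideanSpace ℝ (Fin 3)) ∈ Y.cell a ∧
      (ε 1 : EuclideanSpace ℝ (Fin 3)) ∈ Y.cell b := by
  obtain ⟨ε, hε, hinj, him, hio, a', b', ha, hb, ha', hb'⟩ := exists_arc hc
  have hsub : ∀ u ∈ Set.Icc (0 : ℝ) 1, ε u ∈ Y.cell c := fun u hu => him ▸ ⟨u, hu, rfl⟩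
  have h0 : (0 : ℝ) ∈ Set.Icc (0 : ℝ) 1 := by simp
  have h1 : (1 : ℝ) ∈ Set.Icc (0 : ℝ) 1 := by simp
  have hfa : a' ∈ ({a, b} : Set Y.Cell) := by
    rw [← hf]
    exact ⟨by rw [ha', Set.singleton_subset_iff]; exact hsub 0 h0, by omega⟩
  have hfb : b' ∈ ({a, b} : Set Y.Cell) := by
    rw [← hf]
    exact ⟨by rw [hb', Set.singleton_subset_iff]; exact hsub 1 h1, by omega⟩
  have hne : a' ≠ b' := by
    rintro rfl
    rw [ha', Set.singleton_eq_singleton_iff] at hb'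
    exact zero_ne_one (hinj h0 h1 hb')
  obtain ⟨η, hη, hηinj, hηc, hηo, hηs, hη0, hη1⟩ : ∃ η : ℝ → EuclideanSpace ℝ (Fin 3),
      ContinuousOn η (Set.Icc 0 1) ∧ Set.InjOn η (Set.Icc 0 1) ∧
      (∀ u ∈ Set.Icc (0 : ℝ) 1, η u ∈ Y.cell c) ∧
      (∀ u ∈ Set.Ioo (0 : ℝ) 1, η u ∈ Y.openCell c) ∧
      (∀ y ∈ Y.cell c, ∃ u ∈ Set.Icc (0 : ℝ) 1, η u = y) ∧
      η 0 ∈ Y.cell a ∧ η 1 ∈ Y.cell b := by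
    -- The two end points are distinct, so they exhaust `{a, b}` in one of two orders; in the second
    -- the arc is traversed backwards.
    have hcase : a' = a ∧ b' = b ∨ a' = b ∧ b' = a := by
      rcases hfa with rfl | rfl <;> rcases hfb with rfl | rfl <;> simp_all
    rcases hcase with ⟨rfl, rfl⟩ | ⟨rfl, rfl⟩
    · exact ⟨ε, hε, hinj, hsub, fun u hu => hio ▸ ⟨u, hu, rfl⟩, fun y hy => by rwa [← him] at hy,
        by simp [ha'], by simp [hb']⟩
    · have hm : ∀ u ∈ Set.Icc (0 : ℝ) 1, 1 - u ∈ Set.Icc (0 : ℝ) 1 := fun u hu =>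
        ⟨by linarith [hu.2], by linarith [hu.1]⟩
      refine ⟨fun u => ε (1 - u), hε.comp (by fun_prop) hm, ?_, fun u hu => hsub _ (hm u hu),
        fun u hu => hio ▸ ⟨1 - u, ⟨by linarith [hu.2], by linarith [hu.1]⟩, rfl⟩, ?_,
        by simp [hb'], by simp [ha']⟩
      · intro u hu v hv h
        have := hinj (hm u hu) (hm v hv) h
        linarith
      · intro y hy
        rw [← him] at hy
        obtain ⟨u, hu, rfl⟩ := hy
        exact ⟨1 - u, hm u hu, by simp⟩
  have hsp : ∀ u : Set.Icc (0 : ℝ) 1, η u ∈ Y.space := fun u =>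
    Set.mem_iUnion_of_mem c (hηc u u.2)
  let g : Set.Icc (0 : ℝ) 1 → Y.space := fun u => ⟨η u, hsp u⟩
  have hg : Continuous g := (continuousOn_iff_continuous_domRestrict.1 hη).subtype_mk _
  have hval : ∀ u ∈ Set.Icc (0 : ℝ) 1,
      ((Set.IccExtend (zero_le_one' ℝ) g u : Y.space) : EuclideanSpace ℝ (Fin 3)) = η u :=
    fun u hu => by
      rw [Set.IccExtend_of_mem _ _ hu]
  refine ⟨Set.IccExtend (zero_le_one' ℝ) g, hg.Icc_extend', ?_, ?_, ?_, ?_, ?_, ?_⟩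
  · intro u hu v hv h
    apply hηinj hu hv
    rw [← hval u hu, ← hval v hv, h]
  · intro u hu
    rw [hval u hu]
    exact hηc u hu
  · intro u hu
    rw [hval u (Set.Ioo_subset_Icc_self hu)]
    exact hηo u hu
  · rintro y hy
    obtain ⟨u, hu, huy⟩ := hηs y hy
    exact ⟨u, hu, Subtype.ext ((hval u hu).trans huy)⟩
  · rwa [hval 0 h0]
  · rwa [hval 1 h1]

lemma eq_of_mem_cell_dim_zero {c : Y.Cell} (hc : Y.dim c = 0) {y z : Y.space}
    (hy : (y : EuclideanSpace ℝ (Fin 3)) ∈ Y.cell c)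
    (hz : (z : EuclideanSpace ℝ (Fin 3)) ∈ Y.cell c) : y = z := by
  obtain ⟨p, hp⟩ := exists_cell_eq_singleton hc
  rw [hp] at hy hz
  exact Subtype.ext (hy.trans hz.symm)

lemma exists_div_nat {N : ℕ} (hN : 0 < N) {x : ℝ} (hx : x ∈ Set.Icc (0 : ℝ) 1) :
    (∃ i ≤ N, x = i / N) ∨ ∃ i < N, (i : ℝ) / N < x ∧ x < ((i + 1 : ℕ) : ℝ) / N := by
  have hN' : (0 : ℝ) < N := by exact_mod_cast hN
  have h0 : 0 ≤ x * N := mul_nonneg hx.1 hN'.le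
  have h1 : x * N ≤ N := by nlinarith [hx.2]
  have hle := Nat.floor_le h0
  have hlt := Nat.lt_floor_add_one (x * N)
  have hfl : ⌊x * N⌋₊ ≤ N := by exact_mod_cast hle.trans h1
  rcases hle.eq_or_lt with h | h
  · exact Or.inl ⟨_, hfl, by rw [h]; field_simp⟩
  · refine Or.inr ⟨⌊x * N⌋₊, ?_, ?_, ?_⟩
    · exact_mod_cast h.trans_le h1
    · rwa [div_lt_iff₀ hN']
    · rw [lt_div_iff₀ hN']
      push_cast
      exact hlt

namespace IsBigon

variable {T : Y.Cell} {N : Bool → ℕ} {w c : Bool → ℕ → Y.Cell}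

/-- The two sides of a bigon are arcs. -/
lemma exists_sides (h : IsBigon T N w c) :
    ∃ U : Bool → ℝ → Y.space, (∀ s, Continuous (U s)) ∧
      (∀ s i, i ≤ N s → (U s (i / N s) : EuclideanSpace ℝ (Fin 3)) ∈ Y.cell (w s i)) ∧
      (∀ s i, i < N s → ∀ x, (i : ℝ) / N s ≤ x → x ≤ ((i + 1 : ℕ) : ℝ) / N s →
        (U s x : EuclideanSpace ℝ (Fin 3)) ∈ Y.cell (c s i)) ∧
      (∀ s i, i < N s → ∀ x, (i : ℝ) / N s < x → x < ((i + 1 : ℕ) : ℝ) / N s →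
        (U s x : EuclideanSpace ℝ (Fin 3)) ∈ Y.openCell (c s i)) ∧
      (∀ s i, i < N s → ∀ y : Y.space, (y : EuclideanSpace ℝ (Fin 3)) ∈ Y.cell (c s i) →
        ∃ x, (i : ℝ) / N s ≤ x ∧ x ≤ ((i + 1 : ℕ) : ℝ) / N s ∧ U s x = y) ∧
      (∀ s i, i < N s → Set.InjOn (U s) (Set.Icc ((i : ℝ) / N s) (((i + 1 : ℕ) : ℝ) / N s))) := by
  have : Nonempty Y.space :=
    (Y.openCell_nonempty T).elim fun y hy =>
      ⟨⟨y, Set.mem_iUnion_of_mem T (Y.openCell_subset_cell T hy)⟩⟩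
  have harc := fun s i (hi : i < N s) =>
    exists_arc_of_facets (h.dim_c s i hi) (h.facets s i hi)
  choose! ε hεc hεinj hεm hεo hεs hε0 hε1 using harc
  have hcat : ∀ s, ∃ P : ℝ → Y.space, Continuous P ∧
      ∀ i ≤ N s - 1, ∀ u ∈ Set.Icc (0 : ℝ) 1, P (i + u) = ε s i u := fun s => by
    have := h.pos s
    refine exists_continuous_concat (ε s) (N s - 1) (fun i hi => hεc s i (by omega))
      (fun i hi => ?_)
    exact eq_of_mem_cell_dim_zero (h.dim_w s (i + 1) (by omega)) (hε1 s i (by omega))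
      (hε0 s (i + 1) (by omega))
  choose P hPc hP using hcat
  have hN : ∀ s, (0 : ℝ) < N s := fun s => by exact_mod_cast h.pos s
  have hP' : ∀ s i, i < N s → ∀ x, (i : ℝ) / N s ≤ x → x ≤ ((i + 1 : ℕ) : ℝ) / N s →
      x * N s - i ∈ Set.Icc (0 : ℝ) 1 ∧ P s (x * N s) = ε s i (x * N s - i) := by
    intro s i hi x h0 h1
    rw [div_le_iff₀ (hN s)] at h0
    rw [le_div_iff₀ (hN s)] at h1
    push_cast at h1
    have hmem : x * N s - i ∈ Set.Icc (0 : ℝ) 1 := ⟨by linarith, by linarith⟩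
    refine ⟨hmem, ?_⟩
    rw [← hP s i (by omega) _ hmem]
    congr 1
    ring
  have hstep : ∀ s (i : ℕ), (i : ℝ) / N s ≤ ((i + 1 : ℕ) : ℝ) / N s := fun s i => by
    have := hN s
    gcongr
    simp
  refine ⟨fun s x => P s (x * N s), fun s => (hPc s).comp (by fun_prop), ?_, ?_, ?_, ?_, ?_⟩
  · intro s i hi
    rcases hi.eq_or_lt with rfl | hi
    -- The last vertex starts no edge; it is reached as the end of edge `N s - 1`.
    · obtain ⟨n, hn⟩ : ∃ n, N s = n + 1 := ⟨N s - 1, by have := h.pos s; omega⟩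
      have hn' : n < N s := by omega
      have := hP' s n hn' ((N s : ℕ) / N s) (by
        have := hstep s n; rwa [← hn] at this) (by rw [← hn])
      simp only
      rw [this.2, div_mul_cancel₀ _ (hN s).ne']
      have h2 : ((N s : ℕ) : ℝ) - n = 1 := by rw [hn]; push_cast; ring
      rw [h2]
      have := hε1 s n hn'
      rwa [← hn] at this
    · simp only
      rw [(hP' s i hi _ le_rfl (hstep s i)).2, div_mul_cancel₀ _ (hN s).ne', sub_self]
      exact hε0 s i hi
  · intro s i hi x h0 h1
    obtain ⟨hm, he⟩ := hP' s i hi x h0 h1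
    simp only
    rw [he]
    exact hεm s i hi _ hm
  · intro s i hi x h0 h1
    obtain ⟨hm, he⟩ := hP' s i hi x h0.le h1.le
    simp only
    rw [he]
    rw [div_lt_iff₀ (hN s)] at h0
    rw [lt_div_iff₀ (hN s)] at h1
    push_cast at h1
    exact hεo s i hi _ ⟨by linarith, by linarith⟩
  · intro s i hi y hy
    obtain ⟨u, ⟨hu0, hu1⟩, rfl⟩ := hεs s i hi y hy
    have h0 : (i : ℝ) / N s ≤ (i + u) / N s := by
      have := hN s
      gcongr
      linarith
    have h1 : (i + u) / N s ≤ ((i + 1 : ℕ) : ℝ) / N s := by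
      have := hN s
      push_cast
      gcongr
    refine ⟨(i + u) / N s, h0, h1, ?_⟩
    simp only
    rw [(hP' s i hi _ h0 h1).2, div_mul_cancel₀ _ (hN s).ne', add_sub_cancel_left]
  · intro s i hi x hx x' hx' hxx
    obtain ⟨hm, he⟩ := hP' s i hi x hx.1 hx.2
    obtain ⟨hm', he'⟩ := hP' s i hi x' hx'.1 hx'.2
    simp only at hxx
    rw [he, he'] at hxx
    have := hεinj s i hi hm hm' hxx
    have h3 : x * N s = x' * N s := by linarith
    exact mul_right_cancel₀ (hN s).ne' h3

end IsBigon

end Bigon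

end PolyhedralComplex3

/-! ### Square coordinates on a bigon -/

/-- The segment over `x` goes to a vertical chord of the unit disc. The formula shows that the
circle is met exactly for `t = ±1` or at the collapsed ends. -/
lemma norm_collapse {x t : ℝ} (hx : x ∈ Set.Icc (0 : ℝ) 1) :
    ‖(⟨2 * x - 1, t * (2 * √(x * (1 - x)))⟩ : ℂ)‖ ^ 2 = 1 - 4 * (1 - t ^ 2) * (x * (1 - x)) := by
  rw [← Complex.normSq_eq_norm_sq, Complex.normSq_mk]
  have h := Real.sq_sqrt (mul_nonneg hx.1 (sub_nonneg.2 hx.2))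
  linear_combination (4 * t ^ 2) * h

lemma exists_collapse_eq {z : ℂ} (hz : ‖z‖ ≤ 1) :
    ∃ x ∈ Set.Icc (0 : ℝ) 1, ∃ t ∈ Set.Icc (-1 : ℝ) 1,
      (⟨2 * x - 1, t * (2 * √(x * (1 - x)))⟩ : ℂ) = z := by
  have hz2 : z.re ^ 2 + z.im ^ 2 ≤ 1 := by
    have : ‖z‖ ^ 2 ≤ 1 := by nlinarith [norm_nonneg z]
    rw [← Complex.normSq_eq_norm_sq, Complex.normSq_apply] at this
    linarith
  have hre : z.re ^ 2 ≤ 1 := by nlinarith [sq_nonneg z.im]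
  obtain ⟨h1, h2⟩ := abs_le.1 ((sq_le_one_iff_abs_le_one _).1 hre)
  set x := (1 + z.re) / 2 with hx
  have hx0 : 0 ≤ x * (1 - x) := by rw [hx]; nlinarith
  have hm : (2 * √(x * (1 - x))) ^ 2 = 1 - z.re ^ 2 := by
    rw [mul_pow, Real.sq_sqrt hx0, hx]
    ring
  refine ⟨x, ⟨by rw [hx]; linarith, by rw [hx]; linarith⟩, ?_⟩
  have hm0 : 0 ≤ 2 * √(x * (1 - x)) := by positivity
  generalize 2 * √(x * (1 - x)) = m at hm hm0
  have him : |z.im| ≤ m := abs_le_of_sq_le_sq (by linarith) hm0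
  -- Here `m` is the half-length of the chord. If it vanishes, every `t` gives the same point and
  -- `0` is taken; otherwise `t` is the height divided by `m`.
  rcases hm0.eq_or_lt with rfl | hm0
  · have : z.im = 0 := abs_eq_zero.1 (le_antisymm him (abs_nonneg _))
    exact ⟨0, by simp, Complex.ext (by simp [hx]; ring) (by simp [this])⟩
  · refine ⟨z.im / m, abs_le.1 ?_, Complex.ext (by simp [hx]; ring) ?_⟩
    · rwa [abs_div, abs_of_pos hm0, div_le_one hm0]
    · simp only
      field_simp

namespace PolyhedralComplex3

section Bigon

variable {Y : PolyhedralComplex3}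

lemma sgn_mem (s : Bool) : sgn s ∈ Set.Icc (-1 : ℝ) 1 := by
  cases s <;> simp [sgn]

lemma sgn_sq (s : Bool) : sgn s ^ 2 = 1 := by
  cases s <;> simp [sgn]

lemma sgn_injective : Function.Injective sgn := by
  intro s s' h
  cases s <;> cases s' <;> first | rfl | (norm_num [sgn] at h)

namespace IsBigon

variable {T : Y.Cell} {N : Bool → ℕ} {w c : Bool → ℕ → Y.Cell}

lemma c_ne_w (h : IsBigon T N w c) {s s' : Bool} {i j : ℕ} (hi : i < N s) (hj : j ≤ N s') :
    c s i ≠ w s' j := fun he => by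
  have h1 := h.dim_c s i hi
  rw [he, h.dim_w s' j hj] at h1
  omega

/-- The sides meet only at their common end points. -/
lemma sides_inj (h : IsBigon T N w c) {U : Bool → ℝ → Y.space}
    (hw : ∀ s i, i ≤ N s → (U s (i / N s) : EuclideanSpace ℝ (Fin 3)) ∈ Y.cell (w s i))
    (ho : ∀ s i, i < N s → ∀ x, (i : ℝ) / N s < x → x < ((i + 1 : ℕ) : ℝ) / N s →
      (U s x : EuclideanSpace ℝ (Fin 3)) ∈ Y.openCell (c s i))
    (hinj : ∀ s i, i < N s →
      Set.InjOn (U s) (Set.Icc ((i : ℝ) / N s) (((i + 1 : ℕ) : ℝ) / N s)))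
    {s s' : Bool} {x x' : ℝ} (hx : x ∈ Set.Icc (0 : ℝ) 1) (hx' : x' ∈ Set.Icc (0 : ℝ) 1)
    (he : U s x = U s' x') : s = s' ∧ x = x' ∨ x = 0 ∧ x' = 0 ∨ x = 1 ∧ x' = 1 := by
  have hw' : ∀ s i, i ≤ N s →
      (U s (i / N s) : EuclideanSpace ℝ (Fin 3)) ∈ Y.openCell (w s i) := fun s i hi => by
    rw [openCell_eq_cell (h.dim_w s i hi)]
    exact hw s i hi
  have hN : ∀ s, (N s : ℝ) ≠ 0 := fun s => by exact_mod_cast (h.pos s).ne'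
  rcases exists_div_nat (h.pos s) hx with ⟨i, hi, rfl⟩ | ⟨i, hi, h0, h1⟩ <;>
  rcases exists_div_nat (h.pos s') hx' with ⟨j, hj, rfl⟩ | ⟨j, hj, h0', h1'⟩
  · have hwj := hw' s' j hj
    rw [← he] at hwj
    rcases h.w_inj s s' i j hi hj (eq_of_mem_openCell (hw' s i hi) hwj) with
      ⟨rfl, rfl⟩ | ⟨rfl, rfl⟩ | ⟨rfl, rfl⟩
    · exact Or.inl ⟨rfl, rfl⟩
    · exact Or.inr (Or.inl (by simp))
    · exact Or.inr (Or.inr ⟨div_self (hN s), div_self (hN s')⟩)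
  · have hj' := ho s' j hj _ h0' h1'
    rw [← he] at hj'
    exact absurd (eq_of_mem_openCell hj' (hw' s i hi)) (h.c_ne_w hj hi)
  · have hi' := ho s i hi _ h0 h1
    rw [he] at hi'
    exact absurd (eq_of_mem_openCell hi' (hw' s' j hj)) (h.c_ne_w hi hj)
  · have hj' := ho s' j hj _ h0' h1'
    rw [← he] at hj'
    obtain ⟨rfl, rfl⟩ := h.c_inj s s' i j hi hj (eq_of_mem_openCell (ho s i hi _ h0 h1) hj')
    exact Or.inl ⟨rfl, hinj s i hi ⟨h0.le, h1.le⟩ ⟨h0'.le, h1'.le⟩ he⟩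

/-- The square is collapsed to the unit disc of `ℂ`, the disc is mapped to the model ball by the
radial extension of the boundary parametrization, and the ball to the polygon by `e`. Working
through the boundary circle makes the coordinates agree with the given arcs on the sides. -/
theorem exists_isCoordinate (h : IsBigon T N w c) :
    ∃ b G, IsCoordinate T N w c b G := by
  obtain ⟨U, hUc, hUw, hUm, hUo, hUs, hUi⟩ := h.exists_sides
  obtain ⟨e, he⟩ := exists_homeomorph_closedBall h.subset_top
  have hN : ∀ s, (0 : ℝ) < N s := fun s => by exact_mod_cast h.pos s
  have hinj : ∀ s s', ∀ x ∈ Set.Icc (0 : ℝ) 1, ∀ x' ∈ Set.Icc (0 : ℝ) 1, U s x = U s' x' →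
      s = s' ∧ x = x' ∨ x = 0 ∧ x' = 0 ∨ x = 1 ∧ x' = 1 := fun s s' x hx x' hx' =>
    h.sides_inj hUw hUo hUi hx hx'
  have hU0 : ∀ s s', U s 0 = U s' 0 := fun s s' => by
    have h1 := hUw s 0 (Nat.zero_le _)
    have h2 := hUw s' 0 (Nat.zero_le _)
    rw [h.w_zero s' s] at h2
    simpa using eq_of_mem_cell_dim_zero (h.dim_w s 0 (Nat.zero_le _)) h1 h2
  have hU1 : ∀ s s', U s 1 = U s' 1 := fun s s' => by
    have h1 := hUw s _ le_rfl
    have h2 := hUw s' _ le_rfl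
    rw [h.w_last s' s] at h2
    have := eq_of_mem_cell_dim_zero (h.dim_w s _ le_rfl) h1 h2
    rwa [div_self (hN s).ne', div_self (hN s').ne'] at this
  have hUT : ∀ s, ∀ x ∈ Set.Icc (0 : ℝ) 1, (U s x : EuclideanSpace ℝ (Fin 3)) ∉ Y.openCell T := by
    intro s x hx hT
    rcases exists_div_nat (h.pos s) hx with ⟨i, hi, rfl⟩ | ⟨i, hi, h0, h1⟩
    · have h1 := hUw s i hi
      rw [← openCell_eq_cell (h.dim_w s i hi)] at h1
      have h2 := h.dim_w s i hi
      rw [← eq_of_mem_openCell hT h1, h.dim_top] at h2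
      omega
    · have h2 := h.dim_c s i hi
      rw [← eq_of_mem_openCell hT (hUo s i hi x h0 h1), h.dim_top] at h2
      omega
  have hUsurj : ∀ y : Y.space, (y : EuclideanSpace ℝ (Fin 3)) ∉ Y.openCell T →
      ∃ s, ∃ x ∈ Set.Icc (0 : ℝ) 1, U s x = y := by
    rintro y hy
    have hyT : (y : EuclideanSpace ℝ (Fin 3)) ∈ Y.cell T := by
      obtain ⟨d, hd⟩ := Set.mem_iUnion.1 y.2
      exact h.subset_top d hd
    obtain ⟨d, hd, hyd⟩ := exists_openCell_of_notMem_interior h.dim_top hyT hy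
    obtain hd | hd : Y.dim d = 0 ∨ Y.dim d = 1 := by omega
    · obtain ⟨s, i, hi, rfl⟩ := h.exists_w d hd
      refine ⟨s, i / N s, ⟨by have := hN s; positivity, ?_⟩,
        eq_of_mem_cell_dim_zero hd (hUw s i hi) (Y.openCell_subset_cell _ hyd)⟩
      rw [div_le_one (hN s)]
      exact_mod_cast hi
    · obtain ⟨s, i, hi, rfl⟩ := h.exists_c d hd
      obtain ⟨x, h0, h1, hx⟩ := hUs s i hi y (Y.openCell_subset_cell _ hyd)
      refine ⟨s, x, ⟨le_trans (by have := hN s; positivity) h0, h1.trans ?_⟩, hx⟩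
      rw [div_le_one (hN s)]
      exact_mod_cast hi
  let H : Y.space → EuclideanSpace ℝ (Fin (Y.dim T)) := fun y => e.symm y
  have hHc : Continuous H := continuous_subtype_val.comp e.symm.continuous
  have hHinj : Function.Injective H := Subtype.val_injective.comp e.symm.injective
  have hH1 : ∀ s, ∀ x ∈ Set.Icc (0 : ℝ) 1, ‖H (U s x)‖ = 1 := by
    intro s x hx
    have h1 : ‖H (U s x)‖ ≤ 1 := mem_closedBall_zero_iff.1 (e.symm (U s x)).2
    have h2 := (he (e.symm (U s x))).not.1 (by simpa using hUT s x hx)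
    exact le_antisymm h1 (not_lt.1 h2)
  let q : ℝ → ℝ → ℂ := fun x t => ⟨2 * x - 1, t * (2 * √(x * (1 - x)))⟩
  -- The upper half circle follows side `true`, the lower one side `false`; the branches agree at
  -- `±1`, where the sides meet.
  let φ : ℂ → EuclideanSpace ℝ (Fin (Y.dim T)) := fun z =>
    if 0 ≤ z.im then H (U true ((1 + z.re) / 2)) else H (U false ((1 + z.re) / 2))
  have hqn : ∀ s, ∀ x ∈ Set.Icc (0 : ℝ) 1, ‖q x (sgn s)‖ = 1 := fun s x hx => by
    have h1 := norm_collapse (t := sgn s) hx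
    rw [sgn_sq, sub_self, mul_zero, zero_mul, sub_zero] at h1
    exact (sq_eq_one_iff.1 h1).resolve_right (by linarith [norm_nonneg (q x (sgn s))])
  have hqle : ∀ x ∈ Set.Icc (0 : ℝ) 1, ∀ t ∈ Set.Icc (-1 : ℝ) 1, ‖q x t‖ ≤ 1 :=
    fun x hx t ht => by
      have h1 := norm_collapse (t := t) hx
      have h2 : 0 ≤ (1 - t ^ 2) * (x * (1 - x)) :=
        mul_nonneg (by nlinarith [ht.1, ht.2]) (mul_nonneg hx.1 (sub_nonneg.2 hx.2))
      exact (sq_le_one_iff₀ (norm_nonneg _)).1 (by simp only [q]; linarith)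
  have hq0 : ∀ t t', q 0 t = q 0 t' := fun t t' => by simp [q]
  have hq1 : ∀ t t', q 1 t = q 1 t' := fun t t' => by simp [q]
  have hφq : ∀ s, ∀ x ∈ Set.Icc (0 : ℝ) 1, φ (q x (sgn s)) = H (U s x) := by
    intro s x hx
    have hxx : (1 + (q x (sgn s)).re) / 2 = x := by simp [q]
    have hnn : 0 ≤ √(x * (1 - x)) := Real.sqrt_nonneg _
    simp only [φ, hxx]
    cases s
    · split_ifs with h0
      · simp only [q, sgn, Bool.false_eq_true, if_false] at h0
        have h2 : √(x * (1 - x)) = 0 := by linarith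
        rw [Real.sqrt_eq_zero (mul_nonneg hx.1 (sub_nonneg.2 hx.2))] at h2
        rcases mul_eq_zero.1 h2 with h3 | h3
        · rw [h3, hU0 true false]
        · rw [show x = 1 by linarith, hU1 true false]
      · rfl
    · rw [if_pos]
      simp only [q, sgn, if_true]
      positivity
  have hcirc : ∀ z : ℂ, ‖z‖ = 1 → ∃ s, ∃ x ∈ Set.Icc (0 : ℝ) 1, q x (sgn s) = z := by
    intro z hz
    obtain ⟨x, hx, t, ht, rfl⟩ := exists_collapse_eq hz.le
    have h1 := norm_collapse (t := t) hx
    rw [hz] at h1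
    have h2 : (1 - t ^ 2) * (x * (1 - x)) = 0 := by linarith
    rcases mul_eq_zero.1 h2 with h3 | h3
    · rcases sq_eq_one_iff.1 (show t ^ 2 = 1 by linarith) with rfl | rfl
      · exact ⟨true, x, hx, by simp [q, sgn]⟩
      · exact ⟨false, x, hx, by simp [q, sgn]⟩
    · refine ⟨true, x, hx, ?_⟩
      simp only [q]
      rw [h3]
      simp
  have hφc : ContinuousOn φ (Metric.sphere 0 1) := by
    rw [continuousOn_iff_continuous_domRestrict]
    refine Continuous.if_le (f := fun _ => (0 : ℝ))
      (f' := fun z : Metric.sphere (0 : ℂ) 1 => H (U true ((1 + (z : ℂ).re) / 2)))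
      (g' := fun z : Metric.sphere (0 : ℂ) 1 => H (U false ((1 + (z : ℂ).re) / 2)))
      (g := fun z : Metric.sphere (0 : ℂ) 1 => (z : ℂ).im) ?_ ?_ ?_ ?_ ?_
    · exact hHc.comp ((hUc true).comp (by fun_prop))
    · exact hHc.comp ((hUc false).comp (by fun_prop))
    · fun_prop
    · fun_prop
    · rintro ⟨z, hz⟩ hz0
      have h1 : ‖z‖ ^ 2 = 1 := by rw [mem_sphere_zero_iff_norm.1 hz, one_pow]
      rw [← Complex.normSq_eq_norm_sq, Complex.normSq_apply] at h1
      simp only at hz0 ⊢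
      rw [← hz0] at h1
      rcases sq_eq_one_iff.1 (show z.re ^ 2 = 1 by linarith) with h2 | h2
      · rw [h2]
        norm_num [hU1 true false]
      · rw [h2]
        norm_num [hU0 true false]
  obtain ⟨R, hRc, hRn, hRi, hRs, hRφ⟩ := exists_radial_extension φ hφc
    (by
      intro z hz
      obtain ⟨s, x, hx, rfl⟩ := hcirc z hz
      rw [hφq s x hx, hH1 s x hx])
    (by
      intro z z' hz hz' hzz
      obtain ⟨s, x, hx, rfl⟩ := hcirc z hz
      obtain ⟨s', x', hx', rfl⟩ := hcirc z' hz'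
      rw [hφq s x hx, hφq s' x' hx'] at hzz
      rcases hinj s s' x hx x' hx' (hHinj hzz) with ⟨rfl, rfl⟩ | ⟨rfl, rfl⟩ | ⟨rfl, rfl⟩
      · rfl
      · exact hq0 _ _
      · exact hq1 _ _)
    (by
      intro v hv
      have hvb : v ∈ Metric.closedBall (0 : EuclideanSpace ℝ (Fin (Y.dim T))) 1 :=
        mem_closedBall_zero_iff.2 hv.le
      obtain ⟨s, x, hx, hxv⟩ := hUsurj (e ⟨v, hvb⟩) (by rw [he]; simp [hv])
      refine ⟨q x (sgn s), hqn s x hx, ?_⟩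
      rw [hφq s x hx, hxv]
      simp [H])
  -- Clamping the coordinates makes `G` continuous on the whole plane, and makes it independent of
  -- `t` at `x = 0` and `x = 1` for every real `t`.
  let cl : ℝ → ℝ → ℝ := fun a x => max a (min 1 x)
  have hclm : ∀ a ≤ (1 : ℝ), ∀ x, cl a x ∈ Set.Icc a 1 := fun a ha x =>
    ⟨le_max_left _ _, max_le ha (min_le_left _ _)⟩
  have hcle : ∀ a x, x ∈ Set.Icc a 1 → cl a x = x := fun a x hx => by
    simp only [cl]
    rw [min_eq_right hx.2, max_eq_right hx.1]
  let Q : ℝ × ℝ → ℂ := fun p => q (cl 0 p.1) (cl (-1) p.2)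
  have hQe : ∀ x ∈ Set.Icc (0 : ℝ) 1, ∀ t ∈ Set.Icc (-1 : ℝ) 1, Q (x, t) = q x t :=
    fun x hx t ht => by simp only [Q]; rw [hcle _ _ hx, hcle _ _ ht]
  have hQc : Continuous Q := by
    have h1 : Continuous fun p : ℝ × ℝ => cl 0 p.1 := by fun_prop
    have h2 : Continuous fun p : ℝ × ℝ => cl (-1) p.2 := by fun_prop
    have : Q = fun p => ((2 * cl 0 p.1 - 1 : ℝ) : ℂ) +
        ((cl (-1) p.2 * (2 * √(cl 0 p.1 * (1 - cl 0 p.1))) : ℝ) : ℂ) * Complex.I := by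
      funext p
      exact Complex.mk_eq_add_mul_I _ _
    rw [this]
    fun_prop
  have hQb : ∀ p, R (Q p) ∈ Metric.closedBall (0 : EuclideanSpace ℝ (Fin (Y.dim T))) 1 :=
    fun p => by
      rw [mem_closedBall_zero_iff, hRn]
      exact hqle _ (hclm 0 (by norm_num) _) _ (hclm (-1) (by norm_num) _)
  let G : ℝ × ℝ → Y.space := fun p => e ⟨R (Q p), hQb p⟩
  have hGs : ∀ s, ∀ x ∈ Set.Icc (0 : ℝ) 1, G (x, sgn s) = U s x := by
    intro s x hx
    apply hHinj
    rw [← hφq s x hx, ← hRφ _ (hqn s x hx), ← hQe x hx _ (sgn_mem s)]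
    simp [H, G]
  have hbm : ∀ s i, i ≤ N s → (i : ℝ) / N s ∈ Set.Icc (0 : ℝ) 1 := fun s i hi => by
    refine ⟨by have := hN s; positivity, ?_⟩
    rw [div_le_one (hN s)]
    exact_mod_cast hi
  have hbm' : ∀ s i, i < N s → ∀ x, (i : ℝ) / N s ≤ x → x ≤ ((i + 1 : ℕ) : ℝ) / N s →
      x ∈ Set.Icc (0 : ℝ) 1 := fun s i hi x h0 h1 =>
    ⟨(hbm s i hi.le).1.trans h0, h1.trans (hbm s (i + 1) hi).2⟩
  refine ⟨fun s i => i / N s, G, ⟨?_, ?_, ?_, ?_, ?_, ?_, ?_, ?_, ?_, ?_, ?_, ?_, ?_⟩⟩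
  · exact e.continuous.comp ((hRc.comp hQc).subtype_mk _)
  · intro y
    obtain ⟨z, hz⟩ := hRs (H y)
    have hz1 : ‖z‖ ≤ 1 := by
      rw [← hRn, hz]
      exact mem_closedBall_zero_iff.1 (e.symm y).2
    obtain ⟨x, hx, t, ht, hq⟩ := exists_collapse_eq hz1
    refine ⟨x, hx, t, ht, ?_⟩
    apply hHinj
    rw [← hz, ← hq]
    simp only [G, H, e.symm_apply_apply]
    rw [hQe x hx t ht]
  · intro x hx x' hx' t ht t' ht' hG
    have h1 : R (Q (x, t)) = R (Q (x', t')) := congrArg Subtype.val (e.injective hG)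
    have h2 := hRi h1
    rw [hQe x hx t ht, hQe x' hx' t' ht'] at h2
    have h3 := congrArg Complex.re h2
    have h4 := congrArg Complex.im h2
    simp only [q] at h3 h4
    obtain rfl : x = x' := by linarith
    refine ⟨rfl, ?_⟩
    by_cases hm : √(x * (1 - x)) = 0
    · rw [Real.sqrt_eq_zero (mul_nonneg hx.1 (sub_nonneg.2 hx.2))] at hm
      rcases mul_eq_zero.1 hm with h5 | h5
      · exact Or.inl h5
      · exact Or.inr (Or.inl (by linarith))
    · exact Or.inr (Or.inr (mul_right_cancel₀ (mul_ne_zero two_ne_zero hm) h4))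
  · intro t t'
    have : Q (0, t) = Q (0, t') := by
      simp only [Q]
      rw [hcle 0 0 (by simp)]
      exact hq0 _ _
    simp only [G, this]
  · intro t t'
    have : Q (1, t) = Q (1, t') := by
      simp only [Q]
      rw [hcle 0 1 (by simp)]
      exact hq1 _ _
    simp only [G, this]
  · intro x hx t ht
    rw [he]
    simp only
    rw [hRn, hQe x hx t ht, ← sq_lt_one_iff₀ (norm_nonneg _), norm_collapse hx]
    constructor
    · intro h1
      have h2 : 0 < (1 - t ^ 2) * (x * (1 - x)) := by linarith
      have h3 : 0 ≤ x * (1 - x) := mul_nonneg hx.1 (sub_nonneg.2 hx.2)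
      have h4 : x * (1 - x) ≠ 0 := fun h0 => by rw [h0] at h2; linarith
      have h5 : 1 - t ^ 2 ≠ 0 := fun h0 => by rw [h0] at h2; linarith
      exact ⟨⟨hx.1.lt_of_ne fun h0 => h4 (by rw [← h0]; ring),
        hx.2.lt_of_ne fun h0 => h4 (by rw [h0]; ring)⟩,
        ht.1.lt_of_ne fun h0 => h5 (by rw [← h0]; ring),
        ht.2.lt_of_ne fun h0 => h5 (by rw [h0]; ring)⟩
    · rintro ⟨⟨h1, h2⟩, h3, h4⟩
      have h5 : 0 < (1 - t ^ 2) * (x * (1 - x)) :=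
        mul_pos (by nlinarith) (mul_pos h1 (sub_pos.2 h2))
      linarith
  · intro s
    simp
  · intro s
    exact div_self (hN s).ne'
  · intro s i hi
    have := hN s
    gcongr
    simp
  · intro s i hi
    rw [hGs s _ (hbm s i hi)]
    exact hUw s i hi
  · intro s i hi x h0 h1
    rw [hGs s _ (hbm' s i hi x h0 h1)]
    exact hUm s i hi x h0 h1
  · intro s i hi x h0 h1
    rw [hGs s _ (hbm' s i hi x h0.le h1.le)]
    exact hUo s i hi x h0 h1
  · intro s i hi y hy
    obtain ⟨x, h0, h1, hx⟩ := hUs s i hi y hy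
    exact ⟨x, h0, h1, by rw [hGs s _ (hbm' s i hi x h0 h1), hx]⟩

end IsBigon

end Bigon

end PolyhedralComplex3

/-! ### Tent functions -/

/-- The function with a tent over each interval `[b i, b (i + 1)]`, `i < n`, upside down
when `r i`. -/
noncomputable def tentSum (n : ℕ) (b : ℕ → ℝ) (r : ℕ → Bool) (x : ℝ) : ℝ :=
  ∑ i ∈ Finset.range n, (if r i then -1 else 1) * max 0 (min (x - b i) (b (i + 1) - x))

@[fun_prop]
lemma continuous_tentSum (n : ℕ) (b : ℕ → ℝ) (r : ℕ → Bool) : Continuous (tentSum n b r) := by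
  unfold tentSum
  fun_prop

section TentSum

variable {n : ℕ} {b : ℕ → ℝ} {r : ℕ → Bool}

lemma le_of_forall_lt_succ (hb : ∀ i < n, b i < b (i + 1)) {i j : ℕ} (hij : i ≤ j) (hj : j ≤ n) :
    b i ≤ b j := by
  induction j, hij using Nat.le_induction with
  | base => rfl
  | succ j _ ih => exact (ih (by omega)).trans (hb j (by omega)).le

lemma exists_mem_Icc_succ (hn : 0 < n) {x : ℝ} (h0 : b 0 ≤ x) (h1 : x ≤ b n) :
    ∃ i < n, b i ≤ x ∧ x ≤ b (i + 1) := by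
  induction n with
  | zero => omega
  | succ n ih =>
    by_cases hx : b n ≤ x
    · exact ⟨n, by omega, hx, h1⟩
    · rcases Nat.eq_zero_or_pos n with rfl | hn'
      · exact absurd h0 hx
      · obtain ⟨i, hi, h⟩ := ih hn' (not_le.1 hx).le
        exact ⟨i, by omega, h⟩

lemma tentSum_eq (hb : ∀ i < n, b i < b (i + 1)) {i : ℕ} (hi : i < n) {x : ℝ}
    (h0 : b i ≤ x) (h1 : x ≤ b (i + 1)) :
    tentSum n b r x = (if r i then -1 else 1) * min (x - b i) (b (i + 1) - x) := by
  unfold tentSum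
  rw [Finset.sum_eq_single i]
  · rw [max_eq_right (le_min (sub_nonneg.2 h0) (sub_nonneg.2 h1))]
  · intro j hj hji
    have hj := Finset.mem_range.1 hj
    -- Outside its own interval a tent is truncated to zero, since one of the two differences is
    -- nonpositive there.
    rw [max_eq_left, mul_zero]
    rcases Nat.lt_or_ge j i with h | h
    · have := le_of_forall_lt_succ hb (show j + 1 ≤ i from h) hi.le
      exact (min_le_right _ _).trans (by linarith)
    · have := le_of_forall_lt_succ hb (show i + 1 ≤ j by omega) hj.le
      exact (min_le_left _ _).trans (by linarith)
  · intro h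
    exact absurd (Finset.mem_range.2 hi) h

/-- The height of a tent is the distance to the nearer end of its interval, hence at most the
distance to any breakpoint. With the extreme breakpoints this keeps the diagonal map inside `[0,
1]`; with an intermediate one it compares points on different edges. -/
lemma abs_tentSum_le (hn : 0 < n) (hb : ∀ i < n, b i < b (i + 1)) {k : ℕ} (hk : k ≤ n) {x : ℝ}
    (h0 : b 0 ≤ x) (h1 : x ≤ b n) : |tentSum n b r x| ≤ |x - b k| := by
  obtain ⟨i, hi, hx0, hx1⟩ := exists_mem_Icc_succ hn h0 h1
  rw [tentSum_eq hb hi hx0 hx1, abs_mul,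
    show |(if r i then (-1 : ℝ) else 1)| = 1 by split_ifs <;> simp, one_mul,
    abs_of_nonneg (le_min (sub_nonneg.2 hx0) (sub_nonneg.2 hx1))]
  rcases Nat.lt_or_ge i k with h | h
  · have := le_of_forall_lt_succ hb (show i + 1 ≤ k from h) hk
    rw [abs_of_nonpos (by linarith)]
    exact (min_le_right _ _).trans (by linarith)
  · have := le_of_forall_lt_succ hb h hi.le
    rw [abs_of_nonneg (by linarith)]
    exact (min_le_left _ _).trans (by linarith)

end TentSum

namespace PolyhedralComplex3

/-! ### Degrees zero and one -/

section Degree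

variable {Y : PolyhedralComplex3}

lemma openProdCell_nonempty (a b : Y.Cell) : (Y.openProdCell a b).Nonempty := by
  obtain ⟨y, hy⟩ := Y.openCell_nonempty a
  obtain ⟨z, hz⟩ := Y.openCell_nonempty b
  exact ⟨(⟨y, Set.mem_iUnion_of_mem a (Y.openCell_subset_cell a hy)⟩,
    ⟨z, Set.mem_iUnion_of_mem b (Y.openCell_subset_cell b hz)⟩), hy, hz⟩

lemma hasDegreeModTwo_zero {f : C(Y.space, Y.space × Y.space)} {σ a b : Y.Cell}
    (h : ∀ x : Y.space, (x : EuclideanSpace ℝ (Fin 3)) ∈ Y.cell σ → f x ∉ Y.openProdCell a b) :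
    Y.HasDegreeModTwo f σ a b 0 := by
  refine ⟨Set.univ, isOpen_univ, by simpa using openProdCell_nonempty a b, 0, Fin.elim0,
    fun i => i.elim0, fun _ i => i.elim0, fun x hx => ?_, by simp⟩
  exact absurd hx.2 (h x.1 x.2)

/-- If a map takes a part of a cell bijectively onto an open product cell, then its degree
there is `1`. -/
lemma hasDegreeModTwo_one {f : C(Y.space, Y.space × Y.space)} {σ a b : Y.Cell}
    (h : ∀ y ∈ Y.openProdCell a b,
      ∃! x : Y.space, (x : EuclideanSpace ℝ (Fin 3)) ∈ Y.cell σ ∧ f x = y) :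
    Y.HasDegreeModTwo f σ a b 1 := by
  set S := {x : Y.space // (x : EuclideanSpace ℝ (Fin 3)) ∈ Y.cell σ} with hS
  set O := Set.univ ∩ Y.openProdCell a b with hO
  have : CompactSpace S := by
    have h1 : CompactSpace (Y.cell σ) := isCompact_iff_compactSpace.1 (Y.isCompact_cell σ)
    let g : Y.cell σ → S := fun x => ⟨⟨x, Set.mem_iUnion_of_mem σ x.2⟩, x.2⟩
    have hg : Continuous g := by fun_prop
    exact (show Function.Surjective g from fun x => ⟨⟨x.1, x.2⟩, rfl⟩).compactSpace hg
  let F : S → Y.space × Y.space := fun x => f x.1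
  have hF : Continuous F := f.continuous.comp continuous_subtype_val
  -- The closed cell is compact, so the map is closed, and closedness survives restriction to the
  -- preimage of the open product cell. The resulting closed continuous bijection is a
  -- homeomorphism, whose inverse is the single sheet.
  have hclosed : IsClosedMap (O.restrictPreimage F) := hF.isClosedMap.restrictPreimage O
  have hbij : Function.Bijective (O.restrictPreimage F) := by
    constructor
    · rintro ⟨x, hx⟩ ⟨x', hx'⟩ hxx
      have hxx : f x.1 = f x'.1 := congrArg Subtype.val hxx
      have := (h _ hx.2).unique ⟨x.2, rfl⟩ ⟨x'.2, hxx.symm⟩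
      exact Subtype.ext (Subtype.ext this)
    · rintro ⟨y, hy⟩
      obtain ⟨x, ⟨hx, hxy⟩, -⟩ := h y hy.2
      exact ⟨⟨⟨x, hx⟩, by simpa [F, hxy] using hy⟩, Subtype.ext hxy⟩
  let e := (Equiv.ofBijective _ hbij).toHomeomorphOfContinuousClosed
    (hF.restrictPreimage) hclosed
  have he : ∀ y, F (e.symm y).1 = y.1 := fun y => congrArg Subtype.val (e.apply_symm_apply y)
  refine ⟨Set.univ, isOpen_univ, by simpa using openProdCell_nonempty a b, 1,
    fun _ => ⟨fun y => (e.symm y).1, continuous_subtype_val.comp e.symm.continuous⟩,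
    fun _ y => he y, fun y i j _ => Subsingleton.elim i j, fun x hx => ⟨0, ⟨f x.1, hx⟩, ?_⟩,
    by simp⟩
  exact congrArg Subtype.val (e.symm_apply_apply ⟨x, hx⟩)

end Degree

/-! ### Construction of the diagonal map -/

section Bigon

variable {Y : PolyhedralComplex3} {T : Y.Cell} {N : Bool → ℕ} {w c : Bool → ℕ → Y.Cell}
  {b : Bool → ℕ → ℝ} {G : ℝ × ℝ → Y.space}

/-- The value at coordinates `(x, t)` of half the difference of the first coordinates of the
components of the diagonal map. -/
noncomputable def gap (N : Bool → ℕ) (b : Bool → ℕ → ℝ) (r : Bool → ℕ → Bool) (x t : ℝ) : ℝ :=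
  min x (1 - x) * (1 - max 0 (2 * t - 1) - max 0 (-2 * t - 1)) +
    max 0 (2 * t - 1) * tentSum (N true) (b true) (r true) x +
    max 0 (-2 * t - 1) * tentSum (N false) (b false) (r false) x

/-- The diagonal map in the coordinates of a bigon. -/
structure IsDiagonalMap (N : Bool → ℕ) (b : Bool → ℕ → ℝ) (G : ℝ × ℝ → Y.space)
    (r : Bool → ℕ → Bool) (f : C(Y.space, Y.space × Y.space)) : Prop where
  left : ∀ x t, 0 ≤ x → x ≤ 1 / 2 → -(1 / 2) ≤ t → t ≤ 1 / 2 →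
    f (G (x, t)) = (G (0, 2 * t), G (2 * x, 2 * t))
  right : ∀ x t, 1 / 2 ≤ x → x ≤ 1 → -(1 / 2) ≤ t → t ≤ 1 / 2 →
    f (G (x, t)) = (G (2 * x - 1, 2 * t), G (1, 2 * t))
  side : ∀ s, ∀ x ∈ Set.Icc (0 : ℝ) 1, ∀ τ ∈ Set.Icc (0 : ℝ) 1, ∀ h,
    h = min x (1 - x) * (1 - τ) + τ * tentSum (N s) (b s) (r s) x →
    f (G (x, sgn s * ((1 + τ) / 2))) = (G (x - h, sgn s), G (x + h, sgn s))

namespace IsCoordinate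

lemma abs_tentSum_le_min (hB : IsBigon T N w c) (hG : IsCoordinate T N w c b G)
    (r : Bool → ℕ → Bool) (s : Bool) {x : ℝ} (hx : x ∈ Set.Icc (0 : ℝ) 1) :
    |tentSum (N s) (b s) (r s) x| ≤ min x (1 - x) := by
  have hx0 : b s 0 ≤ x := by rw [hG.b_zero]; exact hx.1
  have hx1 : x ≤ b s (N s) := by rw [hG.b_last]; exact hx.2
  have h0 := abs_tentSum_le (r := r s) (hB.pos s) (hG.b_lt s) (Nat.zero_le _) hx0 hx1
  have h1 := abs_tentSum_le (r := r s) (hB.pos s) (hG.b_lt s) le_rfl hx0 hx1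
  rw [hG.b_zero, sub_zero, abs_of_nonneg hx.1] at h0
  rw [hG.b_last, abs_of_nonpos (show x - 1 ≤ 0 by linarith [hx.2])] at h1
  exact le_min h0 (by linarith)

/-- The formula defines a continuous map on the square, and the square is a compact cover of the
polygon, hence a quotient map. The formula descends because `gap` vanishes at the collapsed ends,
where both components become independent of `t`. -/
theorem exists_isDiagonalMap (hB : IsBigon T N w c) (hG : IsCoordinate T N w c b G)
    (r : Bool → ℕ → Bool) : ∃ f, IsDiagonalMap N b G r f := by
  let K : Set (ℝ × ℝ) := Set.Icc 0 1 ×ˢ Set.Icc (-1) 1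
  have : CompactSpace K := isCompact_iff_compactSpace.1 (isCompact_Icc.prod isCompact_Icc)
  let π : C(K, Y.space) := ⟨fun p => G p, hG.continuous.comp continuous_subtype_val⟩
  have hπ : Topology.IsQuotientMap π := π.continuous.isClosedMap.isQuotientMap π.continuous
    (fun y => by
      obtain ⟨x, hx, t, ht, rfl⟩ := hG.surj y
      exact ⟨⟨(x, t), hx, ht⟩, rfl⟩)
  let cl : ℝ → ℝ := fun t => max (-1) (min 1 (2 * t))
  let F : ℝ × ℝ → Y.space × Y.space := fun p =>
    (G (p.1 - gap N b r p.1 p.2, cl p.2), G (p.1 + gap N b r p.1 p.2, cl p.2))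
  have hgap : Continuous fun p : ℝ × ℝ => gap N b r p.1 p.2 := by
    unfold gap
    fun_prop
  have hcl : Continuous fun p : ℝ × ℝ => cl p.2 := by fun_prop
  have hF : Continuous F :=
    (hG.continuous.comp ((continuous_fst.sub hgap).prodMk hcl)).prodMk
      (hG.continuous.comp ((continuous_fst.add hgap).prodMk hcl))
  have hend : ∀ x, x = 0 ∨ x = 1 → ∀ t, gap N b r x t = 0 := by
    intro x hx t
    have hx' : x ∈ Set.Icc (0 : ℝ) 1 := by rcases hx with rfl | rfl <;> simp
    have hmin : min x (1 - x) = 0 := by rcases hx with rfl | rfl <;> simp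
    have h1 : ∀ s, tentSum (N s) (b s) (r s) x = 0 := fun s => by
      have := hG.abs_tentSum_le_min hB r s hx'
      rw [hmin] at this
      exact abs_eq_zero.1 (le_antisymm this (abs_nonneg _))
    simp [gap, h1, hmin]
  let F' : C(K, Y.space × Y.space) := ⟨fun p => F p, hF.comp continuous_subtype_val⟩
  have hlift : ∀ p p', π p = π p' → F' p = F' p' := by
    rintro ⟨⟨x, t⟩, hx, ht⟩ ⟨⟨x', t'⟩, hx', ht'⟩ hpp
    obtain ⟨rfl, h⟩ := hG.inj x hx x' hx' t ht t' ht' hpp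
    change F (x, t) = F (x, t')
    rcases h with rfl | rfl | rfl
    · simp only [F, hend 0 (Or.inl rfl), sub_zero, add_zero]
      rw [hG.left (cl t) (cl t')]
    · simp only [F, hend 1 (Or.inr rfl), sub_zero, add_zero]
      rw [hG.right (cl t) (cl t')]
    · rfl
  have hf : ∀ x ∈ Set.Icc (0 : ℝ) 1, ∀ t ∈ Set.Icc (-1 : ℝ) 1,
      hπ.lift F' hlift (G (x, t)) = F (x, t) := by
    intro x hx t ht
    exact DFunLike.congr_fun (hπ.lift_comp F' hlift) ⟨(x, t), hx, ht⟩
  have hmid : ∀ x t : ℝ, -(1 / 2) ≤ t → t ≤ 1 / 2 →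
      gap N b r x t = min x (1 - x) ∧ cl t = 2 * t := by
    intro x t h0 h1
    simp only [gap, cl]
    rw [max_eq_left (show 2 * t - 1 ≤ 0 by linarith),
      max_eq_left (show -2 * t - 1 ≤ 0 by linarith), min_eq_right (show 2 * t ≤ 1 by linarith),
      max_eq_right (show -1 ≤ 2 * t by linarith)]
    simp
  refine ⟨hπ.lift F' hlift, ?_, ?_, ?_⟩
  · intro x t h0 h1 h2 h3
    obtain ⟨h4, h5⟩ := hmid x t h2 h3
    rw [hf x ⟨h0, by linarith⟩ t ⟨by linarith, by linarith⟩]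
    simp only [F, h4, h5]
    rw [min_eq_left (by linarith), sub_self, two_mul x]
  · intro x t h0 h1 h2 h3
    obtain ⟨h4, h5⟩ := hmid x t h2 h3
    rw [hf x ⟨by linarith, h1⟩ t ⟨by linarith, by linarith⟩]
    simp only [F, h4, h5]
    rw [min_eq_right (by linarith), show x - (1 - x) = 2 * x - 1 by ring,
      show x + (1 - x) = 1 by ring]
  · rintro s x hx τ ⟨h0, h1⟩ h rfl
    -- At height `(1 + τ) / 2` on side `s` the weight of that side's tent function is `τ`, the
    -- weight of the other is `0`, and doubling and clamping the height lands on the side itself.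
    have hs : gap N b r x (sgn s * ((1 + τ) / 2)) =
        min x (1 - x) * (1 - τ) + τ * tentSum (N s) (b s) (r s) x ∧
        cl (sgn s * ((1 + τ) / 2)) = sgn s := by
      cases s
      · simp only [gap, cl, sgn, Bool.false_eq_true, if_false]
        rw [max_eq_left (show 2 * (-1 * ((1 + τ) / 2)) - 1 ≤ 0 by linarith),
          max_eq_right (show 0 ≤ -2 * (-1 * ((1 + τ) / 2)) - 1 by linarith),
          min_eq_right (show 2 * (-1 * ((1 + τ) / 2)) ≤ 1 by linarith),
          max_eq_left (show 2 * (-1 * ((1 + τ) / 2)) ≤ -1 by linarith)]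
        exact ⟨by ring, rfl⟩
      · simp only [gap, cl, sgn, if_true]
        rw [max_eq_right (show 0 ≤ 2 * (1 * ((1 + τ) / 2)) - 1 by linarith),
          max_eq_left (show -2 * (1 * ((1 + τ) / 2)) - 1 ≤ 0 by linarith),
          min_eq_left (show 1 ≤ 2 * (1 * ((1 + τ) / 2)) by linarith),
          max_eq_right (show (-1 : ℝ) ≤ 1 by norm_num)]
        exact ⟨by ring, rfl⟩
    have hm : sgn s * ((1 + τ) / 2) ∈ Set.Icc (-1 : ℝ) 1 := by
      cases s <;> simp only [sgn, Bool.false_eq_true, if_false, if_true] <;>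
        constructor <;> linarith
    rw [hf x hx _ hm]
    simp only [F, hs.1, hs.2]

end IsCoordinate

end Bigon

end PolyhedralComplex3

namespace PolyhedralComplex3

/-! ### Images and degrees of the diagonal map -/

section Bigon

variable {Y : PolyhedralComplex3} {T : Y.Cell} {N : Bool → ℕ} {w c : Bool → ℕ → Y.Cell}
  {b : Bool → ℕ → ℝ} {G : ℝ × ℝ → Y.space}

lemma IsBigon.mem_cell_top (hB : IsBigon T N w c) (y : Y.space) :
    (y : EuclideanSpace ℝ (Fin 3)) ∈ Y.cell T := by
  obtain ⟨d, hd⟩ := Set.mem_iUnion.1 y.2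
  exact hB.subset_top d hd

lemma IsBigon.cases (hB : IsBigon T N w c) (a : Y.Cell) :
    a = T ∨ (∃ s i, i < N s ∧ a = c s i) ∨ ∃ s i, i ≤ N s ∧ a = w s i := by
  by_cases h : a = T
  · exact Or.inl h
  · have := dim_lt_two hB.dim_top hB.subset_top h
    obtain hd | hd : Y.dim a = 0 ∨ Y.dim a = 1 := by omega
    · exact Or.inr (Or.inr (hB.exists_w a hd))
    · exact Or.inr (Or.inl (hB.exists_c a hd))

namespace IsCoordinate

lemma b_mono (hG : IsCoordinate T N w c b G) {s : Bool} {i j : ℕ} (hij : i ≤ j) (hj : j ≤ N s) :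
    b s i ≤ b s j :=
  le_of_forall_lt_succ (hG.b_lt s) hij hj

lemma b_nonneg (hG : IsCoordinate T N w c b G) {s : Bool} {i : ℕ} (hi : i ≤ N s) : 0 ≤ b s i := by
  rw [← hG.b_zero s]
  exact hG.b_mono (Nat.zero_le i) hi

lemma b_le_one (hG : IsCoordinate T N w c b G) {s : Bool} {i : ℕ} (hi : i ≤ N s) : b s i ≤ 1 := by
  rw [← hG.b_last s]
  exact hG.b_mono hi le_rfl

lemma mem_openCell_w (hB : IsBigon T N w c) (hG : IsCoordinate T N w c b G) {s : Bool} {i : ℕ}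
    (hi : i ≤ N s) : (G (b s i, sgn s) : EuclideanSpace ℝ (Fin 3)) ∈ Y.openCell (w s i) := by
  rw [openCell_eq_cell (hB.dim_w s i hi)]
  exact hG.mem_w s i hi

lemma zero_mem_openCell (hB : IsBigon T N w c) (hG : IsCoordinate T N w c b G) (s : Bool) (t : ℝ) :
    (G (0, t) : EuclideanSpace ℝ (Fin 3)) ∈ Y.openCell (w s 0) := by
  have := hG.mem_openCell_w hB (Nat.zero_le (N s))
  rwa [hG.b_zero, hG.left _ t] at this

lemma one_mem_openCell (hB : IsBigon T N w c) (hG : IsCoordinate T N w c b G) (s : Bool) (t : ℝ) :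
    (G (1, t) : EuclideanSpace ℝ (Fin 3)) ∈ Y.openCell (w s (N s)) := by
  have := hG.mem_openCell_w hB (le_refl (N s))
  rwa [hG.b_last, hG.right _ t] at this

lemma exists_of_mem_openCell_c (hB : IsBigon T N w c) (hG : IsCoordinate T N w c b G) {s : Bool}
    {i : ℕ} (hi : i < N s) {y : Y.space}
    (hy : (y : EuclideanSpace ℝ (Fin 3)) ∈ Y.openCell (c s i)) :
    ∃ x, b s i < x ∧ x < b s (i + 1) ∧ G (x, sgn s) = y := by
  obtain ⟨x, h0, h1, rfl⟩ := hG.exists_of_mem_c s i hi y (Y.openCell_subset_cell _ hy)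
  refine ⟨x, h0.lt_of_ne ?_, h1.lt_of_ne ?_, rfl⟩
  · rintro rfl
    exact hB.c_ne_w hi hi.le (eq_of_mem_openCell hy (hG.mem_openCell_w hB hi.le))
  · rintro rfl
    exact hB.c_ne_w hi hi (eq_of_mem_openCell hy (hG.mem_openCell_w hB hi))

lemma of_mem_openCell_c (hB : IsBigon T N w c) (hG : IsCoordinate T N w c b G) {s : Bool}
    {i : ℕ} (hi : i < N s) {x t : ℝ} (hx : x ∈ Set.Icc (0 : ℝ) 1) (ht : t ∈ Set.Icc (-1 : ℝ) 1)
    (hy : (G (x, t) : EuclideanSpace ℝ (Fin 3)) ∈ Y.openCell (c s i)) :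
    t = sgn s ∧ b s i < x ∧ x < b s (i + 1) := by
  obtain ⟨x', h0, h1, h⟩ := hG.exists_of_mem_openCell_c hB hi hy
  have h2 := hG.b_nonneg hi.le
  have h3 := hG.b_le_one (show i + 1 ≤ N s from hi)
  obtain ⟨rfl, h4⟩ := hG.inj x' ⟨by linarith, by linarith⟩ x hx _ (sgn_mem s) t ht h
  refine ⟨?_, h0, h1⟩
  rcases h4 with h4 | h4 | h4
  · linarith
  · linarith
  · exact h4.symm

lemma eq_c_of_mem_openCell (hB : IsBigon T N w c) (hG : IsCoordinate T N w c b G) {s : Bool}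
    {i : ℕ} (hi : i < N s) {x : ℝ} (h0 : b s i ≤ x) (h1 : x ≤ b s (i + 1)) {a : Y.Cell}
    (ha : Y.dim a = 1) (hx : (G (x, sgn s) : EuclideanSpace ℝ (Fin 3)) ∈ Y.openCell a) :
    a = c s i := by
  rcases h0.eq_or_lt with rfl | h0
  · have h2 := hB.dim_w s i hi.le
    rw [← eq_of_mem_openCell hx (hG.mem_openCell_w hB hi.le)] at h2
    omega
  rcases h1.eq_or_lt with rfl | h1
  · have h2 := hB.dim_w s (i + 1) hi
    rw [← eq_of_mem_openCell hx (hG.mem_openCell_w hB hi)] at h2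
    omega
  · exact eq_of_mem_openCell hx (hG.mem_openCell_c s i hi x h0 h1)

end IsCoordinate

/-- The first vertex of an edge when its end points are exchanged according to `r`. -/
def lowEnd (r : Bool → ℕ → Bool) (s : Bool) (i : ℕ) : ℕ := if r s i then i + 1 else i

/-- The last vertex of an edge when its end points are exchanged according to `r`. -/
def highEnd (r : Bool → ℕ → Bool) (s : Bool) (i : ℕ) : ℕ := if r s i then i else i + 1

lemma lowEnd_highEnd (r : Bool → ℕ → Bool) (s : Bool) (i : ℕ) :
    lowEnd r s i = i ∧ highEnd r s i = i + 1 ∨ lowEnd r s i = i + 1 ∧ highEnd r s i = i := by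
  unfold lowEnd highEnd
  split_ifs <;> simp

namespace IsDiagonalMap

variable {r : Bool → ℕ → Bool} {f : C(Y.space, Y.space × Y.space)}

lemma abs_le_min (hB : IsBigon T N w c) (hG : IsCoordinate T N w c b G) {s : Bool} {x τ h : ℝ}
    (hx : x ∈ Set.Icc (0 : ℝ) 1) (hτ : τ ∈ Set.Icc (0 : ℝ) 1)
    (hh : h = min x (1 - x) * (1 - τ) + τ * tentSum (N s) (b s) (r s) x) :
    |h| ≤ min x (1 - x) := by
  have h1 := hG.abs_tentSum_le_min hB r s hx
  rw [hh]
  obtain ⟨h2, h3⟩ := abs_le.1 h1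
  have h4 : 0 ≤ min x (1 - x) := (abs_nonneg _).trans h1
  rw [abs_le]
  constructor <;> nlinarith [hτ.1, hτ.2]

/-- A point of the polygon lies in the part mapped to `w s 0 × T`, or in the part mapped to
`T × w s (N s)`, or in the part on side `s` mapped to products of edges. -/
lemma cases (hB : IsBigon T N w c) (hG : IsCoordinate T N w c b G) (hf : IsDiagonalMap N b G r f)
    (p : Y.space) :
    (∃ x t, 0 ≤ x ∧ x ≤ 1 / 2 ∧ -(1 / 2) ≤ t ∧ t ≤ 1 / 2 ∧ G (x, t) = p ∧
      f p = (G (0, 2 * t), G (2 * x, 2 * t))) ∨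
    (∃ x t, 1 / 2 ≤ x ∧ x ≤ 1 ∧ -(1 / 2) ≤ t ∧ t ≤ 1 / 2 ∧ G (x, t) = p ∧
      f p = (G (2 * x - 1, 2 * t), G (1, 2 * t))) ∨
    (∃ s x τ h, x ∈ Set.Icc (0 : ℝ) 1 ∧ τ ∈ Set.Icc (0 : ℝ) 1 ∧
      h = min x (1 - x) * (1 - τ) + τ * tentSum (N s) (b s) (r s) x ∧
      x - h ∈ Set.Icc (0 : ℝ) 1 ∧ x + h ∈ Set.Icc (0 : ℝ) 1 ∧
      G (x, sgn s * ((1 + τ) / 2)) = p ∧ f p = (G (x - h, sgn s), G (x + h, sgn s))) := by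
  obtain ⟨x, hx, t, ht, rfl⟩ := hG.surj p
  have hside : ∀ s, ∀ τ ∈ Set.Icc (0 : ℝ) 1, t = sgn s * ((1 + τ) / 2) →
      ∃ s x' τ h, x' ∈ Set.Icc (0 : ℝ) 1 ∧ τ ∈ Set.Icc (0 : ℝ) 1 ∧
      h = min x' (1 - x') * (1 - τ) + τ * tentSum (N s) (b s) (r s) x' ∧
      x' - h ∈ Set.Icc (0 : ℝ) 1 ∧ x' + h ∈ Set.Icc (0 : ℝ) 1 ∧
      G (x', sgn s * ((1 + τ) / 2)) = G (x, t) ∧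
      f (G (x, t)) = (G (x' - h, sgn s), G (x' + h, sgn s)) := by
    intro s τ hτ hst
    have h1 := abs_le_min (r := r) hB hG hx hτ (s := s) rfl
    obtain ⟨h2, h3⟩ := abs_le.1 h1
    have h4 := min_le_left x (1 - x)
    have h5 := min_le_right x (1 - x)
    refine ⟨s, x, τ, _, hx, hτ, rfl, ⟨by linarith, by linarith⟩, ⟨by linarith, by linarith⟩,
      by rw [hst], ?_⟩
    rw [hst]
    exact hf.side s x hx τ hτ _ rfl
  rcases le_or_gt (1 / 2) t with h | h
  · exact Or.inr (Or.inr (hside true (2 * t - 1) ⟨by linarith, by linarith [ht.2]⟩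
      (by simp [sgn])))
  rcases le_or_gt t (-(1 / 2)) with h' | h'
  · exact Or.inr (Or.inr (hside false (-2 * t - 1) ⟨by linarith, by linarith [ht.1]⟩
      (by simp only [sgn, Bool.false_eq_true, if_false]; ring)))
  rcases le_total x (1 / 2) with h0 | h0
  · exact Or.inl ⟨x, t, hx.1, h0, h'.le, h.le, rfl, hf.left x t hx.1 h0 h'.le h.le⟩
  · exact Or.inr (Or.inl ⟨x, t, h0, hx.2, h'.le, h.le, rfl, hf.right x t h0 hx.2 h'.le h.le⟩)

/-- Only the left half of the middle band can have its second component in the open polygon: the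
right half sends it to the final vertex, and the outer strips send it to a side. -/
lemma of_snd_mem_top (hB : IsBigon T N w c) (hG : IsCoordinate T N w c b G)
    (hf : IsDiagonalMap N b G r f) {p : Y.space}
    (hp : ((f p).2 : EuclideanSpace ℝ (Fin 3)) ∈ Y.openCell T) :
    ∃ x t, 0 ≤ x ∧ x ≤ 1 / 2 ∧ -(1 / 2) ≤ t ∧ t ≤ 1 / 2 ∧ G (x, t) = p ∧
      f p = (G (0, 2 * t), G (2 * x, 2 * t)) := by
  rcases hf.cases hB hG p with h | ⟨x, t, h0, h1, h2, h3, -, h5⟩ |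
    ⟨s, x, τ, h, -, -, -, -, h4, -, h5⟩
  · exact h
  · rw [h5] at hp
    have := (hG.mem_top 1 (by simp) (2 * t) ⟨by linarith, by linarith⟩).1 hp
    exact absurd this.1.2 (lt_irrefl _)
  · rw [h5] at hp
    have := (hG.mem_top (x + h) h4 _ (sgn_mem s)).1 hp
    cases s <;> simp [sgn] at this

lemma of_fst_mem_top (hB : IsBigon T N w c) (hG : IsCoordinate T N w c b G)
    (hf : IsDiagonalMap N b G r f) {p : Y.space}
    (hp : ((f p).1 : EuclideanSpace ℝ (Fin 3)) ∈ Y.openCell T) :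
    ∃ x t, 1 / 2 ≤ x ∧ x ≤ 1 ∧ -(1 / 2) ≤ t ∧ t ≤ 1 / 2 ∧ G (x, t) = p ∧
      f p = (G (2 * x - 1, 2 * t), G (1, 2 * t)) := by
  rcases hf.cases hB hG p with ⟨x, t, h0, h1, h2, h3, -, h5⟩ | h |
    ⟨s, x, τ, h, -, -, -, h4, -, -, h5⟩
  · rw [h5] at hp
    have := (hG.mem_top 0 (by simp) (2 * t) ⟨by linarith, by linarith⟩).1 hp
    exact absurd this.1.1 (lt_irrefl _)
  · exact h
  · rw [h5] at hp
    have := (hG.mem_top (x - h) h4 _ (sgn_mem s)).1 hp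
    cases s <;> simp [sgn] at this

lemma of_mem_edges (hB : IsBigon T N w c) (hG : IsCoordinate T N w c b G)
    (hf : IsDiagonalMap N b G r f) {s s' : Bool} {i j : ℕ} (hi : i < N s) (hj : j < N s')
    {p : Y.space} (hp : f p ∈ Y.openProdCell (c s i) (c s' j)) :
    s = s' ∧ ∃ x τ h, x ∈ Set.Icc (0 : ℝ) 1 ∧ τ ∈ Set.Icc (0 : ℝ) 1 ∧
      h = min x (1 - x) * (1 - τ) + τ * tentSum (N s) (b s) (r s) x ∧
      b s i < x - h ∧ x - h < b s (i + 1) ∧ b s j < x + h ∧ x + h < b s (j + 1) ∧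
      G (x, sgn s * ((1 + τ) / 2)) = p ∧ f p = (G (x - h, sgn s), G (x + h, sgn s)) := by
  obtain ⟨hp1, hp2⟩ := hp
  rcases hf.cases hB hG p with ⟨x, t, h0, h1, h2, h3, -, h5⟩ |
    ⟨x, t, h0, h1, h2, h3, -, h5⟩ | ⟨σ, x, τ, h, hx, hτ, hh, h3, h4, h6, h5⟩
  · rw [h5] at hp1
    exact absurd (eq_of_mem_openCell hp1 (hG.zero_mem_openCell hB s _))
      (hB.c_ne_w hi (Nat.zero_le _))
  · rw [h5] at hp2
    exact absurd (eq_of_mem_openCell hp2 (hG.one_mem_openCell hB s' _))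
      (hB.c_ne_w hj le_rfl)
  · rw [h5] at hp1 hp2
    obtain ⟨e1, l1, l2⟩ := hG.of_mem_openCell_c hB hi h3 (sgn_mem σ) hp1
    obtain ⟨e2, l3, l4⟩ := hG.of_mem_openCell_c hB hj h4 (sgn_mem σ) hp2
    obtain rfl := sgn_injective e1
    obtain rfl := sgn_injective e2
    exact ⟨rfl, x, τ, h, hx, hτ, hh, l1, l2, l3, l4, h6, h5⟩

lemma hasDegree_top_left (hB : IsBigon T N w c) (hG : IsCoordinate T N w c b G)
    (hf : IsDiagonalMap N b G r f) (s : Bool) : Y.HasDegreeModTwo f T (w s 0) T 1 := by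
  refine hasDegreeModTwo_one ?_
  rintro ⟨y₁, y₂⟩ ⟨h1, h2⟩
  obtain ⟨x, hx, t, ht, rfl⟩ := hG.surj y₂
  obtain ⟨⟨hx0, hx1⟩, ht0, ht1⟩ := (hG.mem_top x hx t ht).1 h2
  have hy₁ : G (0, t) = y₁ := by
    have h3 := hG.zero_mem_openCell hB s t
    have hd := hB.dim_w s 0 (Nat.zero_le _)
    rw [openCell_eq_cell hd] at h1 h3
    exact eq_of_mem_cell_dim_zero hd h3 h1
  refine ⟨G (x / 2, t / 2), ⟨hB.mem_cell_top _, ?_⟩, ?_⟩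
  · rw [hf.left _ _ (by linarith) (by linarith) (by linarith) (by linarith),
      mul_div_cancel₀ _ two_ne_zero, mul_div_cancel₀ _ two_ne_zero, hy₁]
  · rintro p ⟨-, hp⟩
    obtain ⟨x', t', k0, k1, k2, k3, rfl, k5⟩ := hf.of_snd_mem_top hB hG (p := p) (by rwa [hp])
    rw [hp] at k5
    obtain ⟨e1, e2⟩ := hG.inj x hx (2 * x') ⟨by linarith, by linarith⟩ t ht (2 * t')
      ⟨by linarith, by linarith⟩ (congrArg Prod.snd k5)
    have e3 : t = 2 * t' := e2.resolve_left hx0.ne' |>.resolve_left hx1.ne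
    rw [e1, e3, mul_div_cancel_left₀ _ two_ne_zero, mul_div_cancel_left₀ _ two_ne_zero]

lemma hasDegree_top_right (hB : IsBigon T N w c) (hG : IsCoordinate T N w c b G)
    (hf : IsDiagonalMap N b G r f) (s : Bool) : Y.HasDegreeModTwo f T T (w s (N s)) 1 := by
  refine hasDegreeModTwo_one ?_
  rintro ⟨y₁, y₂⟩ ⟨h1, h2⟩
  obtain ⟨x, hx, t, ht, rfl⟩ := hG.surj y₁
  obtain ⟨⟨hx0, hx1⟩, ht0, ht1⟩ := (hG.mem_top x hx t ht).1 h1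
  have hy₂ : G (1, t) = y₂ := by
    have h3 := hG.one_mem_openCell hB s t
    have hd := hB.dim_w s _ le_rfl
    rw [openCell_eq_cell hd] at h2 h3
    exact eq_of_mem_cell_dim_zero hd h3 h2
  refine ⟨G ((x + 1) / 2, t / 2), ⟨hB.mem_cell_top _, ?_⟩, ?_⟩
  · rw [hf.right _ _ (by linarith) (by linarith) (by linarith) (by linarith),
      mul_div_cancel₀ _ two_ne_zero, mul_div_cancel₀ _ two_ne_zero, hy₂, add_sub_cancel_right]
  · rintro p ⟨-, hp⟩
    obtain ⟨x', t', k0, k1, k2, k3, rfl, k5⟩ := hf.of_fst_mem_top hB hG (p := p) (by rwa [hp])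
    rw [hp] at k5
    obtain ⟨e1, e2⟩ := hG.inj x hx (2 * x' - 1) ⟨by linarith, by linarith⟩ t ht (2 * t')
      ⟨by linarith, by linarith⟩ (congrArg Prod.fst k5)
    have e3 : t = 2 * t' := e2.resolve_left hx0.ne' |>.resolve_left hx1.ne
    rw [e1, e3, sub_add_cancel, mul_div_cancel_left₀ _ two_ne_zero,
      mul_div_cancel_left₀ _ two_ne_zero]

/-- A pair `(α, β)` determines the midpoint `x` and the half-difference `h`. The remaining parameter
`τ` solves an affine equation, which has a unique solution in `[0, 1]` because `h` lies strictly
between the tent value and `min x (1 - x)`. -/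
lemma hasDegree_top_edges (hB : IsBigon T N w c) (hG : IsCoordinate T N w c b G)
    (hf : IsDiagonalMap N b G r f) {s : Bool} {i j : ℕ} (hi : i < N s) (hj : j < N s)
    (hij : i < j ∨ i = j ∧ r s i = true) : Y.HasDegreeModTwo f T (c s i) (c s j) 1 := by
  refine hasDegreeModTwo_one ?_
  rintro ⟨y₁, y₂⟩ hy
  obtain ⟨α, ha0, ha1, rfl⟩ := hG.exists_of_mem_openCell_c hB hi hy.1
  obtain ⟨β, hb0, hb1, rfl⟩ := hG.exists_of_mem_openCell_c hB hj hy.2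
  have i0 := hG.b_nonneg hi.le
  have j0 := hG.b_nonneg hj.le
  have i1 := hG.b_le_one (show i + 1 ≤ N s from hi)
  have j1 := hG.b_le_one (show j + 1 ≤ N s from hj)
  obtain ⟨x, hxdef⟩ : ∃ x, x = (α + β) / 2 := ⟨_, rfl⟩
  obtain ⟨h, hhdef⟩ : ∃ h, h = (β - α) / 2 := ⟨_, rfl⟩
  have hα : x - h = α := by rw [hxdef, hhdef]; ring
  have hβ : x + h = β := by rw [hxdef, hhdef]; ring
  have hx : x ∈ Set.Icc (0 : ℝ) 1 := ⟨by linarith, by linarith⟩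
  have hμ : h < min x (1 - x) := lt_min (by linarith) (by linarith)
  have ht : tentSum (N s) (b s) (r s) x < h := by
    rcases hij with hij | ⟨rfl, hr⟩
    -- The breakpoint `b s (i + 1)` lies between `α` and `β`, so its distance to the midpoint is
    -- less than `h`.
    · have h1 := abs_tentSum_le (r := r s) (hB.pos s) (hG.b_lt s) (show i + 1 ≤ N s from hi)
        (show b s 0 ≤ x by rw [hG.b_zero]; exact hx.1)
        (show x ≤ b s (N s) by rw [hG.b_last]; exact hx.2)
      have h2 := hG.b_mono (show i + 1 ≤ j from hij) hj.le
      exact (le_abs_self _).trans_lt (h1.trans_lt (abs_lt.2 ⟨by linarith, by linarith⟩))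
    -- On a single edge the inverted tent is the negative of the distance to the nearer end, which
    -- exceeds `-h` as both points are interior to the edge.
    · rw [tentSum_eq (hG.b_lt s) hi (by linarith) (by linarith), if_pos hr]
      have : -h < min (x - b s i) (b s (i + 1) - x) := lt_min (by linarith) (by linarith)
      linarith
  have hμt : 0 < min x (1 - x) - tentSum (N s) (b s) (r s) x := by linarith
  obtain ⟨τ, hτdef⟩ : ∃ τ, τ = (min x (1 - x) - h) / (min x (1 - x) -
    tentSum (N s) (b s) (r s) x) := ⟨_, rfl⟩
  have hτeq : ∀ τ', h = min x (1 - x) * (1 - τ') + τ' * tentSum (N s) (b s) (r s) x ↔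
      τ' = τ := fun τ' => by
    rw [hτdef, eq_div_iff hμt.ne']
    constructor <;> intro h <;> linarith
  have hτ : τ ∈ Set.Icc (0 : ℝ) 1 := by
    rw [hτdef]
    refine ⟨div_nonneg (by linarith) hμt.le, ?_⟩
    rw [div_le_one hμt]
    linarith
  refine ⟨G (x, sgn s * ((1 + τ) / 2)), ⟨hB.mem_cell_top _, ?_⟩, ?_⟩
  · rw [hf.side s x hx τ hτ h ((hτeq τ).2 rfl), hα, hβ]
  · rintro p ⟨-, hp⟩
    obtain ⟨-, x', τ', h', hx', hτ', hh', k0, k1, k2, k3, rfl, k5⟩ :=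
      hf.of_mem_edges hB hG hi hj (p := p) (by rwa [hp])
    rw [hp] at k5
    have e1 := (hG.inj α ⟨by linarith, by linarith⟩ (x' - h') ⟨by linarith, by linarith⟩
      _ (sgn_mem s) _ (sgn_mem s) (congrArg Prod.fst k5)).1
    have e2 := (hG.inj β ⟨by linarith, by linarith⟩ (x' + h') ⟨by linarith, by linarith⟩
      _ (sgn_mem s) _ (sgn_mem s) (congrArg Prod.snd k5)).1
    obtain rfl : x' = x := by linarith
    obtain rfl : h' = h := by linarith
    rw [(hτeq τ').1 hh']

/-- In a strip `h` is a convex combination of the tent value and the larger number `min x (1 - x)`,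
so it is never below the tent value. For every excluded pair of edges it would be. -/
lemma eq_and_of_mem_edges (hB : IsBigon T N w c) (hG : IsCoordinate T N w c b G)
    (hf : IsDiagonalMap N b G r f) {s s' : Bool} {i j : ℕ} (hi : i < N s) (hj : j < N s')
    {p : Y.space} (hp : f p ∈ Y.openProdCell (c s i) (c s' j)) :
    s = s' ∧ (i < j ∨ i = j ∧ r s i = true) := by
  obtain ⟨rfl, x, τ, h, hx, hτ, hh, k0, k1, k2, k3, -, -⟩ := hf.of_mem_edges hB hG hi hj hp
  refine ⟨rfl, ?_⟩
  by_contra hij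
  have h0 := hG.abs_tentSum_le_min hB r s hx
  suffices ht : h < tentSum (N s) (b s) (r s) x by
    have hμ : h < min x (1 - x) := ht.trans_le ((le_abs_self _).trans h0)
    rcases hτ.1.eq_or_lt with rfl | hτ0
    · linarith
    · nlinarith [mul_pos hτ0 (sub_pos.2 ht), mul_nonneg (sub_nonneg.2 hτ.2) (sub_pos.2 hμ).le]
  rcases lt_trichotomy i j with hlt | rfl | hlt
  · exact absurd (Or.inl hlt) hij
  · have hr : ¬ r s i = true := fun hr => hij (Or.inr ⟨rfl, hr⟩)
    rw [tentSum_eq (hG.b_lt s) hi (by linarith) (by linarith), if_neg hr, one_mul]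
    exact lt_min (by linarith) (by linarith)
  -- Now `h` is negative and the breakpoint `b s i` separates the two points in the opposite order,
  -- so the tent value, at least `-|x - b s i|`, exceeds `h`.
  · have h1 := abs_tentSum_le (r := r s) (hB.pos s) (hG.b_lt s) hi.le
      (show b s 0 ≤ x by rw [hG.b_zero]; exact hx.1)
      (show x ≤ b s (N s) by rw [hG.b_last]; exact hx.2)
    have h2 := hG.b_mono (show j + 1 ≤ i from hlt) hi.le
    have h3 : |x - b s i| < -h := abs_lt.2 ⟨by linarith, by linarith⟩
    linarith [(abs_le.1 (h1.trans h3.le)).1, neg_abs_le (tentSum (N s) (b s) (r s) x)]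

lemma apply_side (hG : IsCoordinate T N w c b G) (hf : IsDiagonalMap N b G r f) {s : Bool} {i : ℕ}
    (hi : i < N s) {x : ℝ} (h0 : b s i ≤ x) (h1 : x ≤ b s (i + 1)) {h : ℝ}
    (hh : h = (if r s i then -1 else 1) * min (x - b s i) (b s (i + 1) - x)) :
    f (G (x, sgn s)) = (G (x - h, sgn s), G (x + h, sgn s)) := by
  have := hf.side s x ⟨(hG.b_nonneg hi.le).trans h0,
    h1.trans (hG.b_le_one (show i + 1 ≤ N s from hi))⟩ 1 (by simp) h (by
      rw [tentSum_eq (hG.b_lt s) hi h0 h1, hh]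
      ring)
  rwa [show sgn s * ((1 + 1) / 2) = sgn s by ring] at this

/-- The half of the edge next to its low end is stretched over the whole edge by the second
component, while the first stays at the low end. -/
lemma apply_low (hG : IsCoordinate T N w c b G) (hf : IsDiagonalMap N b G r f) {s : Bool} {i : ℕ}
    (hi : i < N s) {z : ℝ} (h0 : b s i ≤ z) (h1 : z ≤ b s (i + 1)) :
    f (G ((z + b s (lowEnd r s i)) / 2, sgn s)) =
      (G (b s (lowEnd r s i), sgn s), G (z, sgn s)) := by
  have hlt := hG.b_lt s i hi
  by_cases hr : r s i = true
  · simp only [lowEnd, hr, if_true]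
    rw [hf.apply_side hG hi (by linarith) (by linarith) (h := (z - b s (i + 1)) / 2) (by
      rw [if_pos hr, min_eq_right (by linarith)]; ring)]
    congr 3 <;> ring
  · simp only [lowEnd, hr]
    rw [if_neg (by simp), hf.apply_side hG hi (by linarith) (by linarith) (h := (z - b s i) / 2) (by
      rw [if_neg hr, min_eq_left (by linarith)]; ring)]
    congr 3 <;> ring

lemma apply_high (hG : IsCoordinate T N w c b G) (hf : IsDiagonalMap N b G r f) {s : Bool} {i : ℕ}
    (hi : i < N s) {z : ℝ} (h0 : b s i ≤ z) (h1 : z ≤ b s (i + 1)) :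
    f (G ((z + b s (highEnd r s i)) / 2, sgn s)) =
      (G (z, sgn s), G (b s (highEnd r s i), sgn s)) := by
  have hlt := hG.b_lt s i hi
  by_cases hr : r s i = true
  · simp only [highEnd, hr, if_true]
    rw [hf.apply_side hG hi (by linarith) (by linarith) (h := (b s i - z) / 2) (by
      rw [if_pos hr, min_eq_left (by linarith)]; ring)]
    congr 3 <;> ring
  · simp only [highEnd, hr]
    rw [if_neg (by simp),
      hf.apply_side hG hi (by linarith) (by linarith) (h := (b s (i + 1) - z) / 2) (by
      rw [if_neg hr, min_eq_right (by linarith)]; ring)]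
    congr 3 <;> ring

lemma cases_edge (hG : IsCoordinate T N w c b G) (hf : IsDiagonalMap N b G r f) {s : Bool} {i : ℕ}
    (hi : i < N s) {p : Y.space} (hp : (p : EuclideanSpace ℝ (Fin 3)) ∈ Y.cell (c s i)) :
    ∃ z, b s i ≤ z ∧ z ≤ b s (i + 1) ∧
      (p = G ((z + b s (lowEnd r s i)) / 2, sgn s) ∧
        f p = (G (b s (lowEnd r s i), sgn s), G (z, sgn s)) ∨
      p = G ((z + b s (highEnd r s i)) / 2, sgn s) ∧
        f p = (G (z, sgn s), G (b s (highEnd r s i), sgn s))) := by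
  obtain ⟨x, h0, h1, rfl⟩ := hG.exists_of_mem_c s i hi p hp
  have hx : ∀ u : ℝ, x = (2 * x - u + u) / 2 := fun u => by ring
  -- Each point belongs to the half of the edge next to one of the two ends; reflecting that end in
  -- the point gives `z`.
  have key : b s i ≤ 2 * x - b s (lowEnd r s i) ∧ 2 * x - b s (lowEnd r s i) ≤ b s (i + 1) ∨
      b s i ≤ 2 * x - b s (highEnd r s i) ∧ 2 * x - b s (highEnd r s i) ≤ b s (i + 1) := by
    rcases lowEnd_highEnd r s i with ⟨e1, e2⟩ | ⟨e1, e2⟩ <;> rw [e1, e2] <;>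
      rcases le_total (2 * x) (b s i + b s (i + 1)) with h | h
    · exact Or.inl ⟨by linarith, by linarith⟩
    · exact Or.inr ⟨by linarith, by linarith⟩
    · exact Or.inr ⟨by linarith, by linarith⟩
    · exact Or.inl ⟨by linarith, by linarith⟩
  rcases key with ⟨k0, k1⟩ | ⟨k0, k1⟩
  · have := hf.apply_low hG hi k0 k1
    rw [← hx] at this
    exact ⟨_, k0, k1, Or.inl ⟨by rw [← hx], this⟩⟩
  · have := hf.apply_high hG hi k0 k1
    rw [← hx] at this
    exact ⟨_, k0, k1, Or.inr ⟨by rw [← hx], this⟩⟩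

lemma lowEnd_le {s : Bool} {i : ℕ} (hi : i < N s) : lowEnd r s i ≤ N s := by
  rcases lowEnd_highEnd r s i with ⟨e1, e2⟩ | ⟨e1, e2⟩ <;> omega

lemma highEnd_le {s : Bool} {i : ℕ} (hi : i < N s) : highEnd r s i ≤ N s := by
  rcases lowEnd_highEnd r s i with ⟨e1, e2⟩ | ⟨e1, e2⟩ <;> omega

lemma of_snd_mem_edge (hB : IsBigon T N w c) (hG : IsCoordinate T N w c b G)
    (hf : IsDiagonalMap N b G r f) {s : Bool} {i : ℕ}
    (hi : i < N s) {p : Y.space} (hp : (p : EuclideanSpace ℝ (Fin 3)) ∈ Y.cell (c s i))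
    {d : Y.Cell} (hd : Y.dim d = 1) (hpd : ((f p).2 : EuclideanSpace ℝ (Fin 3)) ∈ Y.openCell d) :
    d = c s i ∧ ∃ z, b s i ≤ z ∧ z ≤ b s (i + 1) ∧
      p = G ((z + b s (lowEnd r s i)) / 2, sgn s) ∧
        f p = (G (b s (lowEnd r s i), sgn s), G (z, sgn s)) := by
  obtain ⟨z, h0, h1, ⟨h2, h3⟩ | ⟨h2, h3⟩⟩ := hf.cases_edge hG hi hp
  · refine ⟨?_, z, h0, h1, h2, h3⟩
    rw [h3] at hpd
    exact hG.eq_c_of_mem_openCell hB hi h0 h1 hd hpd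
  · rw [h3] at hpd
    have h4 := hB.dim_w s _ (highEnd_le (r := r) hi)
    rw [← eq_of_mem_openCell hpd (hG.mem_openCell_w hB (highEnd_le hi))] at h4
    omega

lemma of_fst_mem_edge (hB : IsBigon T N w c) (hG : IsCoordinate T N w c b G)
    (hf : IsDiagonalMap N b G r f) {s : Bool} {i : ℕ}
    (hi : i < N s) {p : Y.space} (hp : (p : EuclideanSpace ℝ (Fin 3)) ∈ Y.cell (c s i))
    {d : Y.Cell} (hd : Y.dim d = 1) (hpd : ((f p).1 : EuclideanSpace ℝ (Fin 3)) ∈ Y.openCell d) :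
    d = c s i ∧ ∃ z, b s i ≤ z ∧ z ≤ b s (i + 1) ∧
      p = G ((z + b s (highEnd r s i)) / 2, sgn s) ∧
        f p = (G (z, sgn s), G (b s (highEnd r s i), sgn s)) := by
  obtain ⟨z, h0, h1, ⟨h2, h3⟩ | ⟨h2, h3⟩⟩ := hf.cases_edge hG hi hp
  · rw [h3] at hpd
    have h4 := hB.dim_w s _ (lowEnd_le (r := r) hi)
    rw [← eq_of_mem_openCell hpd (hG.mem_openCell_w hB (lowEnd_le hi))] at h4
    omega
  · refine ⟨?_, z, h0, h1, h2, h3⟩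
    rw [h3] at hpd
    exact hG.eq_c_of_mem_openCell hB hi h0 h1 hd hpd

lemma mem_cell_c_half (hG : IsCoordinate T N w c b G) {s : Bool} {i : ℕ} (hi : i < N s) {z u : ℝ}
    (h0 : b s i ≤ z) (h1 : z ≤ b s (i + 1)) (hu : u = b s i ∨ u = b s (i + 1)) :
    (G ((z + u) / 2, sgn s) : EuclideanSpace ℝ (Fin 3)) ∈ Y.cell (c s i) := by
  have := hG.b_lt s i hi
  rcases hu with rfl | rfl <;> exact hG.mem_c s i hi _ (by linarith) (by linarith)

lemma hasDegree_edge_low (hB : IsBigon T N w c) (hG : IsCoordinate T N w c b G)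
    (hf : IsDiagonalMap N b G r f) {s : Bool} {i : ℕ} (hi : i < N s) :
    Y.HasDegreeModTwo f (c s i) (w s (lowEnd r s i)) (c s i) 1 := by
  refine hasDegreeModTwo_one ?_
  rintro ⟨y₁, y₂⟩ ⟨h1, h2⟩
  obtain ⟨z, hz0, hz1, rfl⟩ := hG.exists_of_mem_openCell_c hB hi h2
  have i0 := hG.b_nonneg hi.le
  have i1 := hG.b_le_one (show i + 1 ≤ N s from hi)
  have hy₁ : G (b s (lowEnd r s i), sgn s) = y₁ :=
    eq_of_mem_cell_dim_zero (hB.dim_w s _ (lowEnd_le (r := r) hi)) (hG.mem_w s _ (lowEnd_le hi))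
      (Y.openCell_subset_cell _ h1)
  refine ⟨G ((z + b s (lowEnd r s i)) / 2, sgn s),
    ⟨mem_cell_c_half hG hi hz0.le hz1.le ?_, ?_⟩, ?_⟩
  · rcases lowEnd_highEnd r s i with ⟨e1, e2⟩ | ⟨e1, e2⟩ <;> simp [e1]
  · rw [hf.apply_low hG hi hz0.le hz1.le, hy₁]
  · rintro p ⟨hpc, hp⟩
    obtain ⟨-, z', k0, k1, rfl, k3⟩ :=
      hf.of_snd_mem_edge hB hG hi hpc (hB.dim_c s i hi) (by rwa [hp])
    rw [hp] at k3
    rw [(hG.inj z ⟨by linarith, by linarith⟩ z' ⟨by linarith, by linarith⟩ _ (sgn_mem s) _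
      (sgn_mem s) (congrArg Prod.snd k3)).1]

lemma hasDegree_edge_high (hB : IsBigon T N w c) (hG : IsCoordinate T N w c b G)
    (hf : IsDiagonalMap N b G r f) {s : Bool} {i : ℕ} (hi : i < N s) :
    Y.HasDegreeModTwo f (c s i) (c s i) (w s (highEnd r s i)) 1 := by
  refine hasDegreeModTwo_one ?_
  rintro ⟨y₁, y₂⟩ ⟨h1, h2⟩
  obtain ⟨z, hz0, hz1, rfl⟩ := hG.exists_of_mem_openCell_c hB hi h1
  have i0 := hG.b_nonneg hi.le
  have i1 := hG.b_le_one (show i + 1 ≤ N s from hi)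
  have hy₂ : G (b s (highEnd r s i), sgn s) = y₂ :=
    eq_of_mem_cell_dim_zero (hB.dim_w s _ (highEnd_le (r := r) hi)) (hG.mem_w s _ (highEnd_le hi))
      (Y.openCell_subset_cell _ h2)
  refine ⟨G ((z + b s (highEnd r s i)) / 2, sgn s),
    ⟨mem_cell_c_half hG hi hz0.le hz1.le ?_, ?_⟩, ?_⟩
  · rcases lowEnd_highEnd r s i with ⟨e1, e2⟩ | ⟨e1, e2⟩ <;> simp [e2]
  · rw [hf.apply_high hG hi hz0.le hz1.le, hy₂]
  · rintro p ⟨hpc, hp⟩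
    obtain ⟨-, z', k0, k1, rfl, k3⟩ :=
      hf.of_fst_mem_edge hB hG hi hpc (hB.dim_c s i hi) (by rwa [hp])
    rw [hp] at k3
    rw [(hG.inj z ⟨by linarith, by linarith⟩ z' ⟨by linarith, by linarith⟩ _ (sgn_mem s) _
      (sgn_mem s) (congrArg Prod.fst k3)).1]

lemma apply_vertex (hB : IsBigon T N w c) (hG : IsCoordinate T N w c b G)
    (hf : IsDiagonalMap N b G r f) {s : Bool} {i : ℕ} (hi : i ≤ N s) :
    f (G (b s i, sgn s)) = (G (b s i, sgn s), G (b s i, sgn s)) := by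
  have h0 : tentSum (N s) (b s) (r s) (b s i) = 0 := by
    have := abs_tentSum_le (r := r s) (hB.pos s) (hG.b_lt s) hi
      (hG.b_mono (Nat.zero_le _) hi) (hG.b_mono hi le_rfl)
    rw [sub_self, abs_zero] at this
    exact abs_eq_zero.1 (le_antisymm this (abs_nonneg _))
  have := hf.side s (b s i) ⟨hG.b_nonneg hi, hG.b_le_one hi⟩ 1 (by simp) 0 (by rw [h0]; ring)
  rwa [show sgn s * ((1 + 1) / 2) = sgn s by ring, sub_zero, add_zero] at this

lemma apply_of_dim_zero (hB : IsBigon T N w c) (hG : IsCoordinate T N w c b G)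
    (hf : IsDiagonalMap N b G r f) {v : Y.Cell} (hv : Y.dim v = 0) {p : Y.space}
    (hp : (p : EuclideanSpace ℝ (Fin 3)) ∈ Y.cell v) : f p = (p, p) := by
  obtain ⟨s, i, hi, rfl⟩ := hB.exists_w v hv
  rw [eq_of_mem_cell_dim_zero hv hp (hG.mem_w s i hi)]
  exact hf.apply_vertex hB hG hi

lemma hasDegree_vertex (hB : IsBigon T N w c) (hG : IsCoordinate T N w c b G)
    (hf : IsDiagonalMap N b G r f) {v : Y.Cell} (hv : Y.dim v = 0) :
    Y.HasDegreeModTwo f v v v 1 := by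
  refine hasDegreeModTwo_one ?_
  rintro ⟨y₁, y₂⟩ ⟨h1, h2⟩
  have h1 := Y.openCell_subset_cell _ h1
  have h2 := Y.openCell_subset_cell _ h2
  refine ⟨y₁, ⟨h1, ?_⟩, fun p hp => eq_of_mem_cell_dim_zero hv hp.1 h1⟩
  rw [hf.apply_of_dim_zero hB hG hv h1]
  exact Prod.ext rfl (eq_of_mem_cell_dim_zero hv h1 h2)

theorem carried (hB : IsBigon T N w c) (hG : IsCoordinate T N w c b G)
    (hf : IsDiagonalMap N b G r f) (σ : Y.Cell) (p : Y.space)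
    (hp : (p : EuclideanSpace ℝ (Fin 3)) ∈ Y.cell σ) :
    ((f p).1 : EuclideanSpace ℝ (Fin 3)) ∈ Y.cell σ ∧
    ((f p).2 : EuclideanSpace ℝ (Fin 3)) ∈ Y.cell σ := by
  rcases hB.cases σ with rfl | ⟨s, i, hi, rfl⟩ | ⟨s, i, hi, rfl⟩
  · exact ⟨hB.mem_cell_top _, hB.mem_cell_top _⟩
  · have hlt := (hG.b_lt s i hi).le
    have hlow : (G (b s (lowEnd r s i), sgn s) : EuclideanSpace ℝ (Fin 3)) ∈ Y.cell (c s i) := by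
      rcases lowEnd_highEnd r s i with ⟨e1, e2⟩ | ⟨e1, e2⟩ <;> rw [e1] <;>
        exact hG.mem_c s i hi _ (by linarith) (by linarith)
    have hhigh : (G (b s (highEnd r s i), sgn s) : EuclideanSpace ℝ (Fin 3)) ∈ Y.cell (c s i) := by
      rcases lowEnd_highEnd r s i with ⟨e1, e2⟩ | ⟨e1, e2⟩ <;> rw [e2] <;>
        exact hG.mem_c s i hi _ (by linarith) (by linarith)
    obtain ⟨z, h0, h1, ⟨h2, h3⟩ | ⟨h2, h3⟩⟩ := hf.cases_edge hG hi hp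
    · rw [h3]
      exact ⟨hlow, hG.mem_c s i hi z h0 h1⟩
    · rw [h3]
      exact ⟨hG.mem_c s i hi z h0 h1, hhigh⟩
  · rw [hf.apply_of_dim_zero hB hG (hB.dim_w s i hi) hp]
    exact ⟨hp, hp⟩

/-- On the polygon, the middle band lands in vertex × polygon or polygon × vertex and the strips in
edge × edge, all of dimension two. On an edge one component is always a vertex. -/
theorem cellular (hB : IsBigon T N w c) (hG : IsCoordinate T N w c b G)
    (hf : IsDiagonalMap N b G r f) (σ : Y.Cell) (p : Y.space)
    (hp : (p : EuclideanSpace ℝ (Fin 3)) ∈ Y.cell σ) :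
    ∃ a d : Y.Cell, Y.dim a + Y.dim d ≤ Y.dim σ ∧
      ((f p).1 : EuclideanSpace ℝ (Fin 3)) ∈ Y.cell a ∧
      ((f p).2 : EuclideanSpace ℝ (Fin 3)) ∈ Y.cell d := by
  rcases hB.cases σ with rfl | ⟨s, i, hi, rfl⟩ | ⟨s, i, hi, rfl⟩
  · rcases hf.cases hB hG p with ⟨x, t, h0, h1, h2, h3, -, h5⟩ |
      ⟨x, t, h0, h1, h2, h3, -, h5⟩ | ⟨s, x, τ, h, hx, hτ, hh, h3, h4, h6, h5⟩
    · refine ⟨w true 0, σ, ?_, ?_, hB.mem_cell_top _⟩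
      · rw [hB.dim_w true 0 (Nat.zero_le _), zero_add]
      · rw [h5]
        exact Y.openCell_subset_cell _ (hG.zero_mem_openCell hB true _)
    · refine ⟨σ, w true (N true), ?_, hB.mem_cell_top _, ?_⟩
      · rw [hB.dim_w true _ le_rfl, add_zero]
      · rw [h5]
        exact Y.openCell_subset_cell _ (hG.one_mem_openCell hB true _)
    · have hedge : ∀ u ∈ Set.Icc (0 : ℝ) 1, ∃ i < N s,
          (G (u, sgn s) : EuclideanSpace ℝ (Fin 3)) ∈ Y.cell (c s i) := by
        intro u hu
        obtain ⟨i, hi, k0, k1⟩ := exists_mem_Icc_succ (b := b s) (hB.pos s)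
          (show b s 0 ≤ u by rw [hG.b_zero]; exact hu.1)
          (show u ≤ b s (N s) by rw [hG.b_last]; exact hu.2)
        exact ⟨i, hi, hG.mem_c s i hi u k0 k1⟩
      obtain ⟨i, hi, k0⟩ := hedge _ h3
      obtain ⟨j, hj, k1⟩ := hedge _ h4
      refine ⟨c s i, c s j, ?_, ?_, ?_⟩
      · rw [hB.dim_c s i hi, hB.dim_c s j hj, hB.dim_top]
      · rwa [h5]
      · rwa [h5]
  · obtain ⟨z, h0, h1, ⟨h2, h3⟩ | ⟨h2, h3⟩⟩ := hf.cases_edge hG hi hp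
    · refine ⟨w s (lowEnd r s i), c s i, ?_, ?_, ?_⟩
      · rw [hB.dim_w s _ (lowEnd_le hi), zero_add]
      · rw [h3]
        exact hG.mem_w s _ (lowEnd_le hi)
      · rw [h3]
        exact hG.mem_c s i hi z h0 h1
    · refine ⟨c s i, w s (highEnd r s i), ?_, ?_, ?_⟩
      · rw [hB.dim_w s _ (highEnd_le hi), add_zero]
      · rw [h3]
        exact hG.mem_c s i hi z h0 h1
      · rw [h3]
        exact hG.mem_w s _ (highEnd_le hi)
  · refine ⟨w s i, w s i, ?_, ?_⟩
    · rw [hB.dim_w s i hi]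
    · rw [hf.apply_of_dim_zero hB hG (hB.dim_w s i hi) hp]
      exact ⟨hp, hp⟩

end IsDiagonalMap

lemma contractibleSpace_of_top (hB : IsBigon T N w c) : ContractibleSpace Y.space := by
  obtain ⟨e, -⟩ := exists_homeomorph_closedBall hB.subset_top
  have : ContractibleSpace (Metric.closedBall (0 : EuclideanSpace ℝ (Fin (Y.dim T))) 1) :=
    (convex_closedBall _ _).contractibleSpace ⟨0, by simp⟩
  exact e.symm.contractibleSpace

lemma homotopic_of_contractibleSpace {X Z : Type*} [TopologicalSpace X] [TopologicalSpace Z]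
    [ContractibleSpace Z] (f g : C(X, Z)) : f.Homotopic g := by
  obtain ⟨z, hz⟩ := id_nullhomotopic Z
  have h : ∀ k : C(X, Z), k.Homotopic (ContinuousMap.const X z) := fun k =>
    ContinuousMap.Homotopic.comp hz (ContinuousMap.Homotopic.refl k)
  exact (h f).trans (h g).symm

end Bigon

end PolyhedralComplex3

namespace PolyhedralComplex3

/-! ### The algebraic coproduct of a bigon -/

section Chains

variable {Y : PolyhedralComplex3}

lemma tmul_add_self (x : Y.Chains ⊗[ZMod 2] Y.Chains) : x + x = 0 := by
  rw [← two_smul (ZMod 2) x, show (2 : ZMod 2) = 0 from rfl, zero_smul]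

/-- Doubled terms vanish mod 2. Inserting the terms that occur twice on one side makes both sides
equal as formal sums, so that `abel` applies. -/
lemma eq_of_add_add_self {x y : Y.Chains ⊗[ZMod 2] Y.Chains} (u v : Y.Chains ⊗[ZMod 2] Y.Chains)
    (h : x + (u + u) = y + (v + v)) : x = y := by
  simpa only [tmul_add_self, add_zero] using h

open Classical in
lemma gen_apply (d a : Y.Cell) : Y.gen d a = if a = d then 1 else 0 := by
  unfold gen
  rw [Finsupp.single_apply]
  exact if_congr eq_comm rfl rfl

lemma coeff_tmul (x y : Y.Chains) (a b : Y.Cell) : Y.coeff (x ⊗ₜ y) a b = x a * y b := by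
  simp [coeff]

lemma coeff_add (x y : Y.Chains ⊗[ZMod 2] Y.Chains) (a b : Y.Cell) :
    Y.coeff (x + y) a b = Y.coeff x a b + Y.coeff y a b := by
  simp [coeff]

lemma coeff_sum {ι : Type*} (s : Finset ι) (x : ι → Y.Chains ⊗[ZMod 2] Y.Chains)
    (a b : Y.Cell) : Y.coeff (∑ i ∈ s, x i) a b = ∑ i ∈ s, Y.coeff (x i) a b := by
  simp [coeff, Finsupp.finsetSum_apply]

lemma boundary_gen_eq_sum {σ : Y.Cell} (s : Finset Y.Cell) (hs : ∀ d, Y.IsFacet d σ ↔ d ∈ s) :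
    Y.boundary (Y.gen σ) = ∑ d ∈ s, Y.gen d := by
  unfold boundary
  conv_lhs => rw [gen, Finsupp.linearCombination_single, one_smul]
  refine Finset.sum_congr ?_ fun _ _ => rfl
  ext d
  simp [hs]

variable {T : Y.Cell} {N : Bool → ℕ} {w c : Bool → ℕ → Y.Cell}
  {b : Bool → ℕ → ℝ} {G : ℝ × ℝ → Y.space}

/-- The path along side `s` from its first vertex to the first vertex of the edge `c s j`, when
the end points of the edges are exchanged according to `r`. -/
noncomputable def sideChain (c : Bool → ℕ → Y.Cell) (r : Bool → ℕ → Bool) (s : Bool) (j : ℕ) :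
    Y.Chains :=
  ∑ l ∈ Finset.range j, Y.gen (c s l) + (if r s j then (1 : ZMod 2) else 0) • Y.gen (c s j)

/-- The coproduct of a bigon. -/
noncomputable def topCoproduct (T : Y.Cell) (N : Bool → ℕ) (w c : Bool → ℕ → Y.Cell)
    (r : Bool → ℕ → Bool) : Y.Chains ⊗[ZMod 2] Y.Chains :=
  Y.gen (w true 0) ⊗ₜ Y.gen T + Y.gen T ⊗ₜ Y.gen (w true (N true)) +
    ∑ s, ∑ j ∈ Finset.range (N s), sideChain c r s j ⊗ₜ Y.gen (c s j)

namespace IsBigon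

open Classical in
lemma sideChain_apply (hB : IsBigon T N w c) (r : Bool → ℕ → Bool) {s : Bool} {j : ℕ}
    (hj : j < N s) (a : Y.Cell) : sideChain c r s j a =
      if ∃ i, (i < j ∨ i = j ∧ r s i = true) ∧ a = c s i then 1 else 0 := by
  unfold sideChain
  simp only [Finsupp.add_apply, Finsupp.finsetSum_apply, Finsupp.smul_apply, gen_apply]
  by_cases h : ∃ i ≤ j, a = c s i
  · obtain ⟨i, hi, rfl⟩ := h
    have hiff : ∀ l ≤ j, c s i = c s l ↔ l = i := fun l hl =>
      ⟨fun h => (hB.c_inj s s i l (by omega) (by omega) h).2.symm, fun h => by rw [h]⟩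
    have h1 : (∃ l, (l < j ∨ l = j ∧ r s l = true) ∧ c s i = c s l) ↔
        i < j ∨ i = j ∧ r s i = true := by
      constructor
      · rintro ⟨l, hl, h⟩
        obtain rfl := (hiff l (by omega)).1 h
        exact hl
      · exact fun h => ⟨i, h, rfl⟩
    rw [if_congr h1 rfl rfl, Finset.sum_congr rfl fun l hl =>
      if_congr (hiff l (Finset.mem_range.1 hl).le) rfl rfl, Finset.sum_ite_eq',
      if_congr (hiff j le_rfl) rfl rfl]
    rcases hi.lt_or_eq with hi | rfl
    · simp [hi, hi.ne']
    · simp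
  · have h1 : ¬ ∃ i, (i < j ∨ i = j ∧ r s i = true) ∧ a = c s i := by
      rintro ⟨i, hi, rfl⟩
      exact h ⟨i, by omega, rfl⟩
    rw [if_neg h1, if_neg fun h' => h ⟨j, le_rfl, h'⟩, Finset.sum_eq_zero, smul_zero, add_zero]
    intro l hl
    rw [if_neg fun h' => h ⟨l, (Finset.mem_range.1 hl).le, h'⟩]

lemma c_ne_top (hB : IsBigon T N w c) {s : Bool} {i : ℕ} (hi : i < N s) : c s i ≠ T := fun h => by
  have := hB.dim_c s i hi
  rw [h, hB.dim_top] at this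
  omega

lemma w_ne_top (hB : IsBigon T N w c) {s : Bool} {i : ℕ} (hi : i ≤ N s) : w s i ≠ T := fun h => by
  have := hB.dim_w s i hi
  rw [h, hB.dim_top] at this
  omega

open Classical in
-- The cells of the bigon are distinct, so no basis tensor occurs twice; the condition is the list
-- of product cells that the diagonal map covers.
lemma coeff_topCoproduct (hB : IsBigon T N w c) (r : Bool → ℕ → Bool) (a b : Y.Cell) :
    Y.coeff (topCoproduct T N w c r) a b =
      if (a = w true 0 ∧ b = T) ∨ (a = T ∧ b = w true (N true)) ∨
        ∃ s i j, i < N s ∧ j < N s ∧ (i < j ∨ i = j ∧ r s i = true) ∧ a = c s i ∧ b = c s j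
      then 1 else 0 := by
  have h0 : w true 0 ≠ T := hB.w_ne_top (Nat.zero_le _)
  have h1 : w true (N true) ≠ T := hB.w_ne_top le_rfl
  unfold topCoproduct
  simp only [coeff_add, coeff_sum, coeff_tmul, gen_apply]
  by_cases hb : ∃ s j, j < N s ∧ b = c s j
  · obtain ⟨s, j, hj, rfl⟩ := hb
    have h2 : c s j ≠ T := hB.c_ne_top hj
    have h3 : c s j ≠ w true (N true) := hB.c_ne_w hj le_rfl
    rw [if_neg h2, if_neg h3, mul_zero, mul_zero, zero_add, zero_add, Finset.sum_eq_single s,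
      Finset.sum_eq_single j, if_pos rfl, mul_one, hB.sideChain_apply r hj]
    · refine if_congr ?_ rfl rfl
      constructor
      · rintro ⟨i, hi, rfl⟩
        exact Or.inr (Or.inr ⟨s, i, j, by omega, hj, hi, rfl, rfl⟩)
      · rintro (⟨-, h⟩ | ⟨-, h⟩ | ⟨s', i, j', hi, hj', hij, rfl, h⟩)
        · exact absurd h h2
        · exact absurd h h3
        · obtain ⟨rfl, rfl⟩ := hB.c_inj _ _ _ _ hj hj' h
          exact ⟨i, hij, rfl⟩
    · intro l hl hlj
      rw [if_neg fun h => hlj (hB.c_inj _ _ _ _ hj (Finset.mem_range.1 hl) h).2.symm, mul_zero]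
    · exact fun h => absurd (Finset.mem_range.2 hj) h
    · intro s' _ hs
      refine Finset.sum_eq_zero fun l hl => ?_
      rw [if_neg fun h => hs (hB.c_inj _ _ _ _ hj (Finset.mem_range.1 hl) h).1.symm, mul_zero]
    · exact fun h => absurd (Finset.mem_univ s) h
  · have h2 : ∑ s, ∑ j ∈ Finset.range (N s),
        sideChain c r s j a * (if b = c s j then (1 : ZMod 2) else 0) = 0 := by
      refine Finset.sum_eq_zero fun s _ => Finset.sum_eq_zero fun j hj => ?_
      rw [if_neg fun h => hb ⟨s, j, Finset.mem_range.1 hj, h⟩, mul_zero]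
    have h3 : ¬ ∃ s i j, i < N s ∧ j < N s ∧ (i < j ∨ i = j ∧ r s i = true) ∧
        a = c s i ∧ b = c s j := by
      rintro ⟨s, i, j, -, hj, -, -, h⟩
      exact hb ⟨s, j, hj, h⟩
    rw [h2, add_zero]
    simp only [h3, or_false]
    by_cases hbT : b = T
    · subst hbT
      simp [h1.symm]
    · simp [hbT, ← ite_and, and_comm]

lemma boundary_top (hB : IsBigon T N w c) :
    Y.boundary (Y.gen T) = ∑ s, ∑ j ∈ Finset.range (N s), Y.gen (c s j) := by
  classical
  rw [boundary_gen_eq_sum (((Finset.univ : Finset Bool).sigma fun s => Finset.range (N s)).image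
    fun x => c x.1 x.2), Finset.sum_image, Finset.sum_sigma]
  · rintro ⟨s, i⟩ hi ⟨s', j⟩ hj h
    simp only [Finset.coe_sigma, Set.mem_sigma_iff, Finset.coe_range, Set.mem_Iio] at hi hj
    obtain ⟨rfl, rfl⟩ := hB.c_inj _ _ _ _ hi.2 hj.2 h
    rfl
  · intro d
    simp only [Finset.mem_image, Finset.mem_sigma, Finset.mem_univ, true_and, Finset.mem_range,
      Sigma.exists]
    constructor
    · rintro ⟨-, h⟩
      rw [hB.dim_top] at h
      obtain ⟨s, i, hi, rfl⟩ := hB.exists_c d (by omega)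
      exact ⟨s, i, hi, rfl⟩
    · rintro ⟨s, i, hi, rfl⟩
      exact ⟨hB.subset_top _, by rw [hB.dim_c s i hi, hB.dim_top]⟩

lemma boundary_edge (hB : IsBigon T N w c) {s : Bool} {i : ℕ} (hi : i < N s) :
    Y.boundary (Y.gen (c s i)) = Y.gen (w s i) + Y.gen (w s (i + 1)) := by
  classical
  have hne : w s i ≠ w s (i + 1) := fun h => by
    have := hB.w_inj s s i (i + 1) (by omega) (by omega) h
    omega
  rw [boundary_gen_eq_sum {w s i, w s (i + 1)}, Finset.sum_pair hne]
  intro d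
  have := Set.ext_iff.1 (hB.facets s i hi) d
  simpa using this

lemma boundary_vertex {v : Y.Cell} (hv : Y.dim v = 0) : Y.boundary (Y.gen v) = 0 := by
  rw [boundary_gen_eq_sum ∅, Finset.sum_empty]
  intro d
  simp [IsFacet, hv]

/-- The chain is a path starting at `w s 0`, so its boundary telescopes mod 2. It includes the edge
`c s j` precisely when the low end of that edge is the far one. -/
lemma boundary_sideChain (hB : IsBigon T N w c) (r : Bool → ℕ → Bool) {s : Bool} {j : ℕ}
    (hj : j < N s) : Y.boundary (sideChain c r s j) =
      Y.gen (w s 0) + Y.gen (w s (lowEnd r s j)) := by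
  have hsum : ∀ i ≤ j, ∑ l ∈ Finset.range i, Y.boundary (Y.gen (c s l)) =
      Y.gen (w s 0) + Y.gen (w s i) := by
    intro i hi
    induction i with
    | zero => simp [ZModModule.add_self]
    | succ i ih =>
      rw [Finset.sum_range_succ, ih (by omega), hB.boundary_edge (by omega), add_assoc,
        ← add_assoc (Y.gen (w s i)), ZModModule.add_self, zero_add]
  unfold sideChain lowEnd
  rw [map_add, map_sum, map_smul, hsum j le_rfl, hB.boundary_edge hj]
  split_ifs
  · rw [one_smul, add_assoc, ← add_assoc (Y.gen (w s j)), ZModModule.add_self, zero_add]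
  · simp

/-- Summation by parts: the left factors at consecutive edges share their initial path, leaving a
term at the last vertex and one correction per edge, located at its high end. -/
lemma sum_sideChain_tmul_boundary (hB : IsBigon T N w c) (r : Bool → ℕ → Bool) (s : Bool) :
    ∑ j ∈ Finset.range (N s), sideChain c r s j ⊗ₜ[ZMod 2] Y.boundary (Y.gen (c s j)) =
      (∑ j ∈ Finset.range (N s), Y.gen (c s j)) ⊗ₜ[ZMod 2] Y.gen (w s (N s)) +
      ∑ j ∈ Finset.range (N s), Y.gen (c s j) ⊗ₜ[ZMod 2] Y.gen (w s (highEnd r s j)) := by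
  have key : ∀ n ≤ N s,
      ∑ j ∈ Finset.range n, sideChain c r s j ⊗ₜ[ZMod 2] Y.boundary (Y.gen (c s j)) =
      (∑ j ∈ Finset.range n, Y.gen (c s j)) ⊗ₜ[ZMod 2] Y.gen (w s n) +
      ∑ j ∈ Finset.range n, Y.gen (c s j) ⊗ₜ[ZMod 2] Y.gen (w s (highEnd r s j)) := by
    intro n hn
    induction n with
    | zero => simp
    | succ n ih =>
      rw [Finset.sum_range_succ, ih (by omega), hB.boundary_edge (by omega),
        Finset.sum_range_succ, Finset.sum_range_succ]
      unfold sideChain highEnd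
      generalize ∑ l ∈ Finset.range n, Y.gen (c s l) = C
      split_ifs
      · simp only [one_smul, TensorProduct.add_tmul, TensorProduct.tmul_add]
        refine eq_of_add_add_self 0 (C ⊗ₜ Y.gen (w s n)) ?_
        abel
      · simp only [zero_smul, add_zero, TensorProduct.add_tmul, TensorProduct.tmul_add]
        refine eq_of_add_add_self (Y.gen (c s n) ⊗ₜ Y.gen (w s (n + 1)))
          (C ⊗ₜ Y.gen (w s n)) ?_
        abel
  exact key (N s) le_rfl

theorem exists_coproduct (hB : IsBigon T N w c) (r : Bool → ℕ → Bool) :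
    ∃ D : Y.Chains →ₗ[ZMod 2] Y.Chains ⊗[ZMod 2] Y.Chains,
      D (Y.gen T) = topCoproduct T N w c r ∧
      (∀ s i, i < N s → D (Y.gen (c s i)) =
        Y.gen (w s (lowEnd r s i)) ⊗ₜ Y.gen (c s i) +
          Y.gen (c s i) ⊗ₜ Y.gen (w s (highEnd r s i))) ∧
      ∀ v, Y.dim v = 0 → D (Y.gen v) = Y.gen v ⊗ₜ Y.gen v := by
  -- The value on a cell is fixed by conditions for every possible description of the cell; they are
  -- compatible because an edge determines its side and its index.
  have h : ∀ σ, ∃ d : Y.Chains ⊗[ZMod 2] Y.Chains, (σ = T → d = topCoproduct T N w c r) ∧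
      (∀ s i, i < N s → σ = c s i → d = Y.gen (w s (lowEnd r s i)) ⊗ₜ Y.gen (c s i) +
          Y.gen (c s i) ⊗ₜ Y.gen (w s (highEnd r s i))) ∧
      (Y.dim σ = 0 → d = Y.gen σ ⊗ₜ Y.gen σ) := by
    intro σ
    rcases hB.cases σ with rfl | ⟨s, i, hi, rfl⟩ | ⟨s, i, hi, rfl⟩
    · exact ⟨_, fun _ => rfl, fun s i hi h => absurd h.symm (hB.c_ne_top hi),
        fun h => by rw [hB.dim_top] at h; omega⟩
    · refine ⟨Y.gen (w s (lowEnd r s i)) ⊗ₜ Y.gen (c s i) +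
          Y.gen (c s i) ⊗ₜ Y.gen (w s (highEnd r s i)),
        fun h => absurd h (hB.c_ne_top hi), fun s' j hj h => ?_,
        fun h => by rw [hB.dim_c s i hi] at h; omega⟩
      obtain ⟨rfl, rfl⟩ := hB.c_inj _ _ _ _ hi hj h
      rfl
    · exact ⟨_, fun h => absurd h (hB.w_ne_top hi), fun s' j hj h => absurd h.symm (hB.c_ne_w hj hi),
        fun _ => rfl⟩
  choose d hd1 hd2 hd3 using h
  have hD : ∀ σ, Finsupp.linearCombination (ZMod 2) d (Y.gen σ) = d σ := fun σ => by
    rw [gen, Finsupp.linearCombination_single, one_smul]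
  refine ⟨Finsupp.linearCombination (ZMod 2) d, ?_, fun s i hi => ?_, fun v hv => ?_⟩
  · rw [hD]
    exact hd1 T rfl
  · rw [hD]
    exact hd2 _ s i hi rfl
  · rw [hD]
    exact hd3 v hv

lemma boundaryTensor_tmul (x y : Y.Chains) :
    Y.boundaryTensor (x ⊗ₜ y) = Y.boundary x ⊗ₜ y + x ⊗ₜ Y.boundary y := by
  simp [boundaryTensor]

/-- On the polygon, the sums over the sides produce the edge coproducts plus (initial vertex) ⊗ side
and side ⊗ (final vertex). Both sides share their end points, so these extra terms cancel the
boundaries of the two primitive terms. -/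
lemma chainMap_of_coproduct (hB : IsBigon T N w c) (r : Bool → ℕ → Bool)
    {D : Y.Chains →ₗ[ZMod 2] Y.Chains ⊗[ZMod 2] Y.Chains}
    (hT : D (Y.gen T) = topCoproduct T N w c r)
    (hc : ∀ s i, i < N s → D (Y.gen (c s i)) =
        Y.gen (w s (lowEnd r s i)) ⊗ₜ Y.gen (c s i) +
          Y.gen (c s i) ⊗ₜ Y.gen (w s (highEnd r s i)))
    (hw : ∀ v, Y.dim v = 0 → D (Y.gen v) = Y.gen v ⊗ₜ Y.gen v) :
    Y.boundaryTensor ∘ₗ D = D ∘ₗ Y.boundary := by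
  refine Finsupp.lhom_ext' fun σ => LinearMap.ext_ring ?_
  change Y.boundaryTensor (D (Y.gen σ)) = D (Y.boundary (Y.gen σ))
  rcases hB.cases σ with rfl | ⟨s, i, hi, rfl⟩ | ⟨s, i, hi, rfl⟩
  · rw [hT, hB.boundary_top, map_sum]
    have h1 : ∀ s, D (∑ j ∈ Finset.range (N s), Y.gen (c s j)) =
        ∑ j ∈ Finset.range (N s), Y.gen (w s (lowEnd r s j)) ⊗ₜ[ZMod 2] Y.gen (c s j) +
        ∑ j ∈ Finset.range (N s), Y.gen (c s j) ⊗ₜ[ZMod 2] Y.gen (w s (highEnd r s j)) := by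
      intro s
      rw [map_sum, ← Finset.sum_add_distrib]
      exact Finset.sum_congr rfl fun j hj => hc s j (Finset.mem_range.1 hj)
    have h2 : ∀ s, Y.boundaryTensor
        (∑ j ∈ Finset.range (N s), sideChain c r s j ⊗ₜ[ZMod 2] Y.gen (c s j)) =
        Y.gen (w s 0) ⊗ₜ[ZMod 2] (∑ j ∈ Finset.range (N s), Y.gen (c s j)) +
        ∑ j ∈ Finset.range (N s), Y.gen (w s (lowEnd r s j)) ⊗ₜ[ZMod 2] Y.gen (c s j) +
        ((∑ j ∈ Finset.range (N s), Y.gen (c s j)) ⊗ₜ[ZMod 2] Y.gen (w s (N s)) +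
        ∑ j ∈ Finset.range (N s), Y.gen (c s j) ⊗ₜ[ZMod 2] Y.gen (w s (highEnd r s j))) := by
      intro s
      rw [← hB.sum_sideChain_tmul_boundary r s, TensorProduct.tmul_sum, ← Finset.sum_add_distrib,
        ← Finset.sum_add_distrib, map_sum]
      refine Finset.sum_congr rfl fun j hj => ?_
      rw [boundaryTensor_tmul, hB.boundary_sideChain r (Finset.mem_range.1 hj),
        TensorProduct.add_tmul]
    unfold topCoproduct
    rw [map_add, map_add, boundaryTensor_tmul, boundaryTensor_tmul, hB.boundary_top,
      boundary_vertex (hB.dim_w true 0 (Nat.zero_le _)), boundary_vertex (hB.dim_w true _ le_rfl),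
      TensorProduct.zero_tmul, TensorProduct.tmul_zero, Fintype.sum_bool, Fintype.sum_bool,
      Fintype.sum_bool, map_add, h1, h1, h2, h2, hB.w_zero false true, hB.w_last false true,
      TensorProduct.tmul_add, TensorProduct.add_tmul]
    generalize ∑ j ∈ Finset.range (N true), Y.gen (c true j) = C₁
    generalize ∑ j ∈ Finset.range (N false), Y.gen (c false j) = C₂
    refine eq_of_add_add_self 0 (Y.gen (w true 0) ⊗ₜ C₁ + Y.gen (w true 0) ⊗ₜ C₂ +
      C₁ ⊗ₜ Y.gen (w true (N true)) + C₂ ⊗ₜ Y.gen (w true (N true))) ?_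
    abel
  · rw [hc s i hi, hB.boundary_edge hi, map_add, map_add, boundaryTensor_tmul,
      boundaryTensor_tmul, hw _ (hB.dim_w s i hi.le), hw _ (hB.dim_w s (i + 1) hi),
      boundary_vertex (hB.dim_w s _ (IsDiagonalMap.lowEnd_le hi)),
      boundary_vertex (hB.dim_w s _ (IsDiagonalMap.highEnd_le hi)), hB.boundary_edge hi]
    rcases lowEnd_highEnd r s i with ⟨e1, e2⟩ | ⟨e1, e2⟩ <;> rw [e1, e2] <;>
      simp only [TensorProduct.add_tmul, TensorProduct.tmul_add, TensorProduct.zero_tmul,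
        TensorProduct.tmul_zero]
    · refine eq_of_add_add_self 0 (Y.gen (w s i) ⊗ₜ Y.gen (w s (i + 1))) ?_
      abel
    · refine eq_of_add_add_self 0 (Y.gen (w s (i + 1)) ⊗ₜ Y.gen (w s i)) ?_
      abel
  · rw [hw _ (hB.dim_w s i hi), boundaryTensor_tmul, boundary_vertex (hB.dim_w s i hi)]
    simp

end IsBigon

end Chains

end PolyhedralComplex3

namespace PolyhedralComplex3

/-! ### The coproduct is induced by the map; polygons as bigons -/

section Bigon

variable {Y : PolyhedralComplex3} {T : Y.Cell} {N : Bool → ℕ} {w c : Bool → ℕ → Y.Cell}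
  {b : Bool → ℕ → ℝ} {G : ℝ × ℝ → Y.space}

/-- To verify the cellular chain of a cell, it is enough that each product cell is either covered
once or not at all. -/
lemma isInducedBy_of_indicator {f : C(Y.space, Y.space × Y.space)}
    {D : Y.Chains →ₗ[ZMod 2] Y.Chains ⊗[ZMod 2] Y.Chains}
    (h : ∀ σ, ∃ P : Y.Cell → Y.Cell → Prop,
      (∀ a d, (P a d → Y.coeff (D (Y.gen σ)) a d = 1) ∧
        (¬ P a d → Y.coeff (D (Y.gen σ)) a d = 0)) ∧
      (∀ a d, P a d → Y.dim a + Y.dim d = Y.dim σ ∧ Y.HasDegreeModTwo f σ a d 1) ∧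
      ∀ a d, Y.dim a + Y.dim d = Y.dim σ →
        ∀ p : Y.space, (p : EuclideanSpace ℝ (Fin 3)) ∈ Y.cell σ →
          f p ∈ Y.openProdCell a d → P a d) :
    Y.IsInducedBy f D := by
  intro σ a d
  obtain ⟨P, h1, h2, h3⟩ := h σ
  by_cases hP : P a d
  · rw [(h1 a d).1 hP]
    exact ⟨fun _ => (h2 a d hP).2, fun h => absurd (h2 a d hP).1 h⟩
  · rw [(h1 a d).2 hP]
    exact ⟨fun hd => hasDegreeModTwo_zero fun p hp hpd => hP (h3 a d hd p hp hpd), fun _ => rfl⟩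

namespace IsBigon

/-- For each cell, the product cells covered by the diagonal map are exactly those with coefficient
one, and each is covered once. -/
theorem isInducedBy (hB : IsBigon T N w c) (hG : IsCoordinate T N w c b G)
    {r : Bool → ℕ → Bool} {f : C(Y.space, Y.space × Y.space)} (hf : IsDiagonalMap N b G r f)
    {D : Y.Chains →ₗ[ZMod 2] Y.Chains ⊗[ZMod 2] Y.Chains}
    (hT : D (Y.gen T) = topCoproduct T N w c r)
    (hc : ∀ s i, i < N s → D (Y.gen (c s i)) =
        Y.gen (w s (lowEnd r s i)) ⊗ₜ Y.gen (c s i) +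
          Y.gen (c s i) ⊗ₜ Y.gen (w s (highEnd r s i)))
    (hw : ∀ v, Y.dim v = 0 → D (Y.gen v) = Y.gen v ⊗ₜ Y.gen v) :
    Y.IsInducedBy f D := by
  refine isInducedBy_of_indicator fun σ => ?_
  have hdim : ∀ a, a = T ∨ Y.dim a < 2 := fun a =>
    or_iff_not_imp_left.2 (dim_lt_two hB.dim_top hB.subset_top)
  rcases hB.cases σ with rfl | ⟨s, i, hi, rfl⟩ | ⟨s, i, hi, rfl⟩
  · refine ⟨fun a d => (a = w true 0 ∧ d = σ) ∨ (a = σ ∧ d = w true (N true)) ∨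
      ∃ s i j, i < N s ∧ j < N s ∧ (i < j ∨ i = j ∧ r s i = true) ∧ a = c s i ∧ d = c s j,
      fun a d => ?_, ?_, ?_⟩
    · rw [hT, hB.coeff_topCoproduct r a d]
      exact ⟨fun h => if_pos h, fun h => if_neg h⟩
    · rintro a d (⟨rfl, rfl⟩ | ⟨rfl, rfl⟩ | ⟨s, i, j, hi, hj, hij, rfl, rfl⟩)
      · exact ⟨by rw [hB.dim_w true 0 (Nat.zero_le _), zero_add],
          hf.hasDegree_top_left hB hG true⟩
      · exact ⟨by rw [hB.dim_w true _ le_rfl, add_zero], hf.hasDegree_top_right hB hG true⟩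
      · exact ⟨by rw [hB.dim_c s i hi, hB.dim_c s j hj, hB.dim_top],
          hf.hasDegree_top_edges hB hG hi hj hij⟩
    · intro a d had p hp hpd
      rw [hB.dim_top] at had
      rcases hdim a with rfl | ha
      · obtain ⟨x, t, -, -, -, -, -, h⟩ := hf.of_fst_mem_top hB hG hpd.1
        have := hpd.2
        rw [h] at this
        exact Or.inr (Or.inl ⟨rfl, eq_of_mem_openCell this (hG.one_mem_openCell hB true _)⟩)
      rcases hdim d with rfl | hd
      · obtain ⟨x, t, -, -, -, -, -, h⟩ := hf.of_snd_mem_top hB hG hpd.2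
        have := hpd.1
        rw [h] at this
        exact Or.inl ⟨eq_of_mem_openCell this (hG.zero_mem_openCell hB true _), rfl⟩
      obtain ⟨s, i, hi, rfl⟩ := hB.exists_c a (by omega)
      obtain ⟨s', j, hj, rfl⟩ := hB.exists_c d (by omega)
      obtain ⟨rfl, hij⟩ := hf.eq_and_of_mem_edges hB hG hi hj hpd
      exact Or.inr (Or.inr ⟨s, i, j, hi, hj, hij, rfl, rfl⟩)
  · refine ⟨fun a d => (a = w s (lowEnd r s i) ∧ d = c s i) ∨
      (a = c s i ∧ d = w s (highEnd r s i)), fun a d => ?_, ?_, ?_⟩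
    · have h1 : c s i ≠ w s (lowEnd r s i) := hB.c_ne_w hi (IsDiagonalMap.lowEnd_le hi)
      rw [hc s i hi, coeff_add, coeff_tmul, coeff_tmul, gen_apply, gen_apply, gen_apply, gen_apply]
      constructor
      · rintro (⟨rfl, rfl⟩ | ⟨rfl, rfl⟩)
        · simp [h1.symm]
        · simp [h1]
      · intro h
        obtain ⟨h2, h3⟩ := not_or.1 h
        rw [ite_zero_mul_ite_zero, ite_zero_mul_ite_zero, if_neg h2, if_neg h3, add_zero]
    · rintro a d (⟨rfl, rfl⟩ | ⟨rfl, rfl⟩)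
      · exact ⟨by rw [hB.dim_w s _ (IsDiagonalMap.lowEnd_le hi), zero_add],
          hf.hasDegree_edge_low hB hG hi⟩
      · exact ⟨by rw [hB.dim_w s _ (IsDiagonalMap.highEnd_le hi), add_zero],
          hf.hasDegree_edge_high hB hG hi⟩
    · intro a d had p hp hpd
      rw [hB.dim_c s i hi] at had
      obtain hd | ha : Y.dim d = 1 ∨ Y.dim a = 1 := by omega
      · obtain ⟨rfl, z, -, -, -, h⟩ := hf.of_snd_mem_edge hB hG hi hp hd hpd.2
        have := hpd.1
        rw [h] at this
        exact Or.inl ⟨eq_of_mem_openCell this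
          (hG.mem_openCell_w hB (IsDiagonalMap.lowEnd_le hi)), rfl⟩
      · obtain ⟨rfl, z, -, -, -, h⟩ := hf.of_fst_mem_edge hB hG hi hp ha hpd.1
        have := hpd.2
        rw [h] at this
        exact Or.inr ⟨rfl, eq_of_mem_openCell this
          (hG.mem_openCell_w hB (IsDiagonalMap.highEnd_le hi))⟩
  · have hv := hB.dim_w s i hi
    refine ⟨fun a d => a = w s i ∧ d = w s i, fun a d => ?_, ?_, ?_⟩
    · rw [hw _ hv, coeff_tmul, gen_apply, gen_apply, ite_zero_mul_ite_zero, mul_one]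
      exact ⟨fun h => if_pos h, fun h => if_neg h⟩
    · rintro a d ⟨rfl, rfl⟩
      exact ⟨by rw [hv], hf.hasDegree_vertex hB hG hv⟩
    · intro a d _ p hp hpd
      have hp' := hp
      rw [← openCell_eq_cell hv] at hp'
      obtain ⟨h1, h2⟩ := hpd
      rw [hf.apply_of_dim_zero hB hG hv hp] at h1 h2
      exact ⟨eq_of_mem_openCell h1 hp', eq_of_mem_openCell h2 hp'⟩

/-- A bigon, with arbitrary orientations of its edges, has a diagonal approximation with the
coproduct `topCoproduct`. -/
theorem exists_isDiagonalApproximation (hB : IsBigon T N w c) (r : Bool → ℕ → Bool) :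
    ∃ (Δ : C(Y.space, Y.space × Y.space)) (D : Y.Chains →ₗ[ZMod 2] Y.Chains ⊗[ZMod 2] Y.Chains),
      Y.IsDiagonalApproximation Δ D ∧ D (Y.gen T) = topCoproduct T N w c r := by
  obtain ⟨b, G, hG⟩ := hB.exists_isCoordinate
  obtain ⟨f, hf⟩ := hG.exists_isDiagonalMap hB r
  obtain ⟨D, hT, hc, hw⟩ := hB.exists_coproduct r
  have := contractibleSpace_of_top hB
  exact ⟨f, D, ⟨hf.cellular hB hG, homotopic_of_contractibleSpace _ _, hf.carried hB hG,
    hB.isInducedBy hG hf hT hc hw, hB.chainMap_of_coproduct r hT hc hw⟩, hT⟩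

end IsBigon

/-- The number of edges on the sides of a `k`-gon from its first to its `m`-th vertex. -/
def sideLength (k m : ℕ) (s : Bool) : ℕ := if s then m - 1 else k + 1 - m

/-- The vertices on the sides of a `k`-gon with first vertex `v 1`. -/
def sideVertex {α : Type*} (k : ℕ) (v : ℕ → α) (s : Bool) (i : ℕ) : α :=
  if s then v (i + 1) else if i = 0 then v 1 else v (k + 1 - i)

/-- The edges on the sides of a `k`-gon, `e 1` and `e k` being those at the first vertex. -/
def sideEdge {α : Type*} (k : ℕ) (e : ℕ → α) (s : Bool) (i : ℕ) : α :=
  if s then e (i + 1) else e (k - i)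

/-- Any vertex other than the first may serve as the second marked vertex. Side `true` runs through
`v 1, v 2, …, v m`, side `false` through `v 1, v k, …, v m`; the initial vertex of side `false` is
treated separately because its index would be `k + 1`. -/
lemma IsCyclicTuple.isBigon {k : ℕ} {v e : ℕ → Y.Cell} (h : Y.IsCyclicTuple k v e)
    (hT : Y.dim T = 2) (htop : ∀ x, Y.cell x ⊆ Y.cell T) {m : ℕ} (hm2 : 2 ≤ m) (hmk : m ≤ k) :
    IsBigon T (sideLength k m) (sideVertex k v) (sideEdge k e) := by
  have hv : ∀ i j, 1 ≤ i → i ≤ k → 1 ≤ j → j ≤ k → v i = v j → i = j :=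
    fun i j h1 h2 h3 h4 h5 => h.vertices.injOn ⟨h1, h2⟩ ⟨h3, h4⟩ h5
  have he : ∀ i j, 1 ≤ i → i ≤ k → 1 ≤ j → j ≤ k → e i = e j → i = j :=
    fun i j h1 h2 h3 h4 h5 => h.edges.injOn ⟨h1, h2⟩ ⟨h3, h4⟩ h5
  have hv0 : ∀ i, 1 ≤ i → i ≤ k → Y.dim (v i) = 0 := fun i h1 h2 => h.vertices.mapsTo ⟨h1, h2⟩
  have he1 : ∀ i, 1 ≤ i → i ≤ k → Y.dim (e i) = 1 := fun i h1 h2 => h.edges.mapsTo ⟨h1, h2⟩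
  have hidx : ∀ s i, i ≤ sideLength k m s → ∃ j, 1 ≤ j ∧ j ≤ k ∧ sideVertex k v s i = v j ∧
      (s = true ∧ j = i + 1 ∨ s = false ∧ (i = 0 ∧ j = 1 ∨ 0 < i ∧ j + i = k + 1)) := by
    intro s i hi
    cases s
    · simp only [sideLength, Bool.false_eq_true, if_false] at hi
      simp only [sideVertex, Bool.false_eq_true, if_false]
      split_ifs with h0
      · exact ⟨1, by omega, by omega, rfl, Or.inr ⟨trivial, by omega⟩⟩
      · exact ⟨k + 1 - i, by omega, by omega, rfl, Or.inr ⟨trivial, by omega⟩⟩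
    · simp only [sideLength, if_true] at hi
      exact ⟨i + 1, by omega, by omega, by simp [sideVertex], by simp⟩
  have hidx' : ∀ s i, i < sideLength k m s → ∃ j, 1 ≤ j ∧ j ≤ k ∧ sideEdge k e s i = e j ∧
      (s = true ∧ j = i + 1 ∧ j < m ∨ s = false ∧ j + i = k ∧ m ≤ j) := by
    intro s i hi
    cases s
    · simp only [sideLength, Bool.false_eq_true, if_false] at hi
      exact ⟨k - i, by omega, by omega, by simp [sideEdge], Or.inr ⟨rfl, by omega⟩⟩
    · simp only [sideLength, if_true] at hi
      exact ⟨i + 1, by omega, by omega, by simp [sideEdge], Or.inl ⟨rfl, by omega⟩⟩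
  have hlen : sideLength k m true = m - 1 ∧ sideLength k m false = k + 1 - m := by
    simp [sideLength]
  refine ⟨hT, htop, ?_, ?_, ?_, ?_, ?_, ?_, ?_, ?_, ?_, ?_⟩
  · intro s
    cases s <;> omega
  · intro s i hi
    obtain ⟨j, h1, h2, h3, -⟩ := hidx s i hi
    rw [h3]
    exact hv0 j h1 h2
  · intro s i hi
    obtain ⟨j, h1, h2, h3, -⟩ := hidx' s i hi
    rw [h3]
    exact he1 j h1 h2
  · intro s s'
    cases s <;> cases s' <;> simp [sideVertex]
  · have : sideVertex k v true (m - 1) = sideVertex k v false (k + 1 - m) := by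
      simp only [sideVertex, if_true, Bool.false_eq_true, if_false]
      rw [if_neg (by omega)]
      congr 1
      omega
    intro s s'
    cases s <;> cases s' <;> simp only [hlen.1, hlen.2, this]
  · intro s s' i j hi hj hij
    obtain ⟨i', h1, h2, h3, h4⟩ := hidx s i hi
    obtain ⟨j', h1', h2', h3', h4'⟩ := hidx s' j hj
    rw [h3, h3'] at hij
    obtain rfl := hv i' j' h1 h2 h1' h2' hij
    cases s <;> cases s' <;> simp only [true_and, false_and, or_false, false_or, reduceCtorEq,
      hlen.1, hlen.2] at * <;> omega
  · intro s s' i j hi hj hij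
    obtain ⟨i', h1, h2, h3, h4⟩ := hidx' s i hi
    obtain ⟨j', h1', h2', h3', h4'⟩ := hidx' s' j hj
    rw [h3, h3'] at hij
    obtain rfl := he i' j' h1 h2 h1' h2' hij
    cases s <;> cases s' <;> simp only [true_and, false_and, or_false, false_or, reduceCtorEq] at * <;>
      omega
  · intro x hx
    obtain ⟨j, ⟨h1, h2⟩, rfl⟩ := h.vertices.surjOn hx
    by_cases hj : j ≤ m
    · refine ⟨true, j - 1, by omega, ?_⟩
      simp only [sideVertex, if_true]
      congr 1
      omega
    · refine ⟨false, k + 1 - j, by omega, ?_⟩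
      simp only [sideVertex, Bool.false_eq_true, if_false]
      rw [if_neg (by omega)]
      congr 1
      omega
  · intro x hx
    obtain ⟨j, ⟨h1, h2⟩, rfl⟩ := h.edges.surjOn hx
    by_cases hj : j < m
    · refine ⟨true, j - 1, by omega, ?_⟩
      simp only [sideEdge, if_true]
      congr 1
      omega
    · refine ⟨false, k - j, by omega, ?_⟩
      simp only [sideEdge, Bool.false_eq_true, if_false]
      congr 1
      omega
  · intro s i hi
    cases s
    · rw [hlen.2] at hi
      simp only [sideEdge, sideVertex, Bool.false_eq_true, if_false]
      rw [if_neg (Nat.succ_ne_zero i), show k + 1 - (i + 1) = k - i by omega]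
      split_ifs with h0
      · subst h0
        rw [Nat.sub_zero, h.ends_last, Set.pair_comm]
      · rw [h.ends (k - i) (by omega) (by omega), show k - i + 1 = k + 1 - i by omega,
          Set.pair_comm]
    · rw [hlen.1] at hi
      simp only [sideEdge, sideVertex, if_true]
      exact h.ends (i + 1) (by omega) (by omega)

end Bigon

end PolyhedralComplex3

/-! ### Translation into the numbering of the cyclic tuple -/

lemma sum_range_eq_add_sum_Icc_two {M : Type*} [AddCommMonoid M] (H : ℕ → M) {n : ℕ}
    (hn : 1 ≤ n) :
    ∑ i ∈ Finset.range n, H i = H 0 + ∑ j ∈ Finset.Icc 2 n, H (j - 1) := by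
  obtain ⟨n, rfl⟩ := Nat.exists_eq_add_of_le' hn
  rw [Finset.sum_range_succ', add_comm]
  congr 1
  refine Finset.sum_nbij' (fun i => i + 2) (fun j => j - 2) ?_ ?_ ?_ ?_ ?_ <;> intro i hi <;>
    simp only [Finset.mem_range, Finset.mem_Icc] at hi ⊢
  · omega
  · omega
  · omega
  · omega
  · rfl

/-- Side `false` meets the edges in decreasing order of index. The separated term belongs to the
edge `e k` at the first vertex and later vanishes. -/
lemma sum_range_eq_add_sum_Icc_reverse {M : Type*} [AddCommMonoid M] (H : ℕ → M) {k m : ℕ}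
    (hm : 1 ≤ m) (hmk : m ≤ k) :
    ∑ i ∈ Finset.range (k + 1 - m), H i = H 0 + ∑ j ∈ Finset.Icc m (k - 1), H (k - j) := by
  rw [show k + 1 - m = (k - m) + 1 by omega, Finset.sum_range_succ', add_comm]
  congr 1
  refine Finset.sum_nbij' (fun i => k - (i + 1)) (fun j => k - j - 1) ?_ ?_ ?_ ?_ ?_ <;>
    intro i hi <;> simp only [Finset.mem_range, Finset.mem_Icc] at hi ⊢
  · omega
  · omega
  · omega
  · omega
  · congr 1
    omega

namespace PolyhedralComplex3

variable {Y : PolyhedralComplex3}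

/-- The exchange of end points that orients the edges of a `k`-gon towards increasing numbers. -/
def sideReversed {α : Type*} (k : ℕ) (v : ℕ → α) (ν : α → ℕ) (s : Bool) (i : ℕ) : Bool :=
  decide (ν (sideVertex k v s (i + 1)) < ν (sideVertex k v s i))

lemma sideReversed_true {α : Type*} (k : ℕ) (v : ℕ → α) (ν : α → ℕ) (i : ℕ) :
    sideReversed k v ν true i = true ↔ ν (v (i + 2)) < ν (v (i + 1)) := by
  simp [sideReversed, sideVertex]

lemma sideReversed_false_zero {α : Type*} (k : ℕ) (v : ℕ → α) (ν : α → ℕ) :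
    sideReversed k v ν false 0 = true ↔ ν (v k) < ν (v 1) := by
  simp [sideReversed, sideVertex]

/-- Side `false` runs along `e j` from `v (j + 1)` to `v j`, so reversal there means an ascent in
the cyclic order. This is the source of the coefficient `1 + lam j`, against `lam j` on the other
side. -/
lemma sideReversed_false {α : Type*} (k : ℕ) (v : ℕ → α) (ν : α → ℕ) {j : ℕ} (hj : j < k) :
    sideReversed k v ν false (k - j) = true ↔ ν (v j) < ν (v (j + 1)) := by
  simp only [sideReversed, sideVertex, Bool.false_eq_true, if_false, decide_eq_true_eq]
  rw [if_neg (Nat.succ_ne_zero _), if_neg (by omega), show k + 1 - (k - j + 1) = j by omega,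
    show k + 1 - (k - j) = j + 1 by omega]

lemma sideChain_true (k : ℕ) (e : ℕ → Y.Cell) (r : Bool → ℕ → Bool) {j : ℕ} (hj : 2 ≤ j) :
    sideChain (sideEdge k e) r true (j - 1) = Y.gen (e 1) +
      ∑ l ∈ Finset.Icc 2 (j - 1), Y.gen (e l) +
      (if r true (j - 1) then (1 : ZMod 2) else 0) • Y.gen (e j) := by
  simp only [sideChain, sideEdge, if_true]
  rw [sum_range_eq_add_sum_Icc_two _ (by omega : 1 ≤ j - 1), show j - 1 + 1 = j by omega]
  congr 2
  refine Finset.sum_congr rfl fun l hl => ?_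
  rw [show l - 1 + 1 = l by have := Finset.mem_Icc.1 hl; omega]

lemma sideChain_false (k : ℕ) (e : ℕ → Y.Cell) (r : Bool → ℕ → Bool) {j : ℕ} (hj : j < k) :
    sideChain (sideEdge k e) r false (k - j) =
      (if r false (k - j) then (1 : ZMod 2) else 0) • Y.gen (e j) +
        ∑ l ∈ Finset.Icc (j + 1) (k - 1), Y.gen (e l) + Y.gen (e k) := by
  simp only [sideChain, sideEdge, Bool.false_eq_true, if_false]
  rw [show k - j = k + 1 - (j + 1) by omega, sum_range_eq_add_sum_Icc_reverse _ (by omega) (by omega),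
    show k + 1 - (j + 1) = k - j by omega, show k - (k - j) = j by omega, Nat.sub_zero]
  have : ∑ l ∈ Finset.Icc (j + 1) (k - 1), Y.gen (e (k - (k - l))) =
      ∑ l ∈ Finset.Icc (j + 1) (k - 1), Y.gen (e l) := by
    refine Finset.sum_congr rfl fun l hl => ?_
    rw [show k - (k - l) = l by have := Finset.mem_Icc.1 hl; omega]
  rw [this]
  abel

/-- At the first edge of a side the path is empty unless that edge is reversed. This removes the
terms with `u₂` or `uₖ` as right factor, since edges at the minimal vertex are never reversed. -/
lemma sideChain_zero {c : Bool → ℕ → Y.Cell} {r : Bool → ℕ → Bool} {s : Bool}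
    (h : ¬ r s 0 = true) : sideChain c r s 0 = 0 := by
  simp [sideChain, h]

end PolyhedralComplex3

theorem theorem4p1 (X : PolyhedralComplex3)
    -- an arbitrary numbering of the vertices of `X` from `1` to `n`
    (n : ℕ) (ν : X.Cell → ℕ) (hν : Set.BijOn ν {c | X.dim c = 0} (Set.Icc 1 n))
    -- a polygon `p = ⟨v 1, …, v k⟩` of `X`, starting from its minimal vertex
    (p : X.Cell) (hp : X.dim p = 2)
    (k : ℕ) (v e : ℕ → (X.faceComplex p).Cell)
    (htuple : (X.faceComplex p).IsCyclicTuple k v e)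
    (hmin : ∀ j, 1 ≤ j → j ≤ k → ν (v 1).1 ≤ ν (v j).1)
    -- `m` is the position of the maximal vertex
    (m : ℕ) (hm2 : 2 ≤ m) (hmk : m ≤ k)
    (hmax : ∀ j, 2 ≤ j → j ≤ k → ν (v j).1 ≤ ν (v m).1)
    -- the descent indicators
    (lam : ℕ → ZMod 2) (hlam : ∀ j, lam j = if ν (v j).1 < ν (v (j + 1)).1 then 0 else 1)
    -- the cellular chains given by the vertices, by `p`, by the edges, and by the edges
    -- `u₂ = ⟨v 1, v 2⟩` and `u_k = ⟨v 1, v k⟩` at the minimal vertex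
    (V E : ℕ → (X.faceComplex p).Chains) (P u₂ uₖ : (X.faceComplex p).Chains)
    (hV : ∀ j, V j = (X.faceComplex p).gen (v j))
    (hE : ∀ j, E j = (X.faceComplex p).gen (e j))
    (hP : P = (X.faceComplex p).gen (X.topCell p))
    (hu₂ : u₂ = (X.faceComplex p).gen (e 1))
    (huₖ : uₖ = (X.faceComplex p).gen (e k)) :
    ∃ (Δ : C((X.faceComplex p).space, (X.faceComplex p).space × (X.faceComplex p).space))
      (D : (X.faceComplex p).Chains →ₗ[ZMod 2]
        (X.faceComplex p).Chains ⊗[ZMod 2] (X.faceComplex p).Chains),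
      (X.faceComplex p).IsDiagonalApproximation Δ D ∧
      D P = V 1 ⊗ₜ[ZMod 2] P + P ⊗ₜ[ZMod 2] V m
        + ∑ j ∈ Finset.Icc 2 (m - 1),
            (u₂ + ∑ l ∈ Finset.Icc 2 (j - 1), E l + lam j • E j) ⊗ₜ[ZMod 2] E j
        + ∑ j ∈ Finset.Icc m (k - 1),
            ((1 + lam j) • E j + ∑ l ∈ Finset.Icc (j + 1) (k - 1), E l + uₖ) ⊗ₜ[ZMod 2] E j := by
  subst hP hu₂ huₖ
  obtain rfl : V = fun j => (X.faceComplex p).gen (v j) := funext hV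
  obtain rfl : E = fun j => (X.faceComplex p).gen (e j) := funext hE
  have hk := htuple.three_le
  -- Distinct vertices have distinct numbers, so a failed strict ascent is a strict descent, as
  -- reversal requires.
  have hinj : ∀ i j, 1 ≤ i → i ≤ k → 1 ≤ j → j ≤ k → ν (v i).1 = ν (v j).1 → i = j := by
    intro i j h1 h2 h3 h4 h
    have hi : (X.faceComplex p).dim (v i) = 0 := htuple.vertices.mapsTo ⟨h1, h2⟩
    have hj : (X.faceComplex p).dim (v j) = 0 := htuple.vertices.mapsTo ⟨h3, h4⟩
    exact htuple.vertices.injOn ⟨h1, h2⟩ ⟨h3, h4⟩ (Subtype.ext (hν.injOn hi hj h))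
  have hB := htuple.isBigon (T := X.topCell p) hp (fun x => x.2) hm2 hmk
  obtain ⟨Δ, D, hΔ, hD⟩ := hB.exists_isDiagonalApproximation
    (PolyhedralComplex3.sideReversed k v fun x => ν x.1)
  refine ⟨Δ, D, hΔ, ?_⟩
  rw [hD]
  unfold PolyhedralComplex3.topCoproduct
  rw [Fintype.sum_bool, ← add_assoc]
  have hw0 : PolyhedralComplex3.sideVertex k v true 0 = v 1 := by
    simp [PolyhedralComplex3.sideVertex]
  have hwm : PolyhedralComplex3.sideVertex k v true (PolyhedralComplex3.sideLength k m true) =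
      v m := by
    simp only [PolyhedralComplex3.sideVertex, PolyhedralComplex3.sideLength, if_true]
    congr 1
    omega
  rw [hw0, hwm]
  congr 1
  · congr 1
    rw [show PolyhedralComplex3.sideLength k m true = m - 1 by
      simp [PolyhedralComplex3.sideLength], sum_range_eq_add_sum_Icc_two _ (by omega),
      PolyhedralComplex3.sideChain_zero, TensorProduct.zero_tmul, zero_add]
    · refine Finset.sum_congr rfl fun j hj => ?_
      obtain ⟨h2, hjm⟩ := Finset.mem_Icc.1 hj
      rw [PolyhedralComplex3.sideChain_true k e _ h2, hlam j]
      have hne : ν (v j).1 ≠ ν (v (j + 1)).1 := fun h => by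
        have := hinj j (j + 1) (by omega) (by omega) (by omega) (by omega) h
        omega
      have hr := PolyhedralComplex3.sideReversed_true k v (fun x => ν x.1) (j - 1)
      rw [show j - 1 + 2 = j + 1 by omega, show j - 1 + 1 = j by omega] at hr
      have he : PolyhedralComplex3.sideEdge k e true (j - 1) = e j := by
        simp only [PolyhedralComplex3.sideEdge, if_true]
        congr 1
        omega
      rw [he]
      by_cases h : ν (v j).1 < ν (v (j + 1)).1
      · rw [if_pos h, if_neg fun h' => lt_asymm h (hr.1 h')]
      · rw [if_neg h, if_pos (hr.2 (lt_of_le_of_ne (not_lt.1 h) hne.symm))]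
    · rw [PolyhedralComplex3.sideReversed_true]
      exact not_lt.2 (hmin 2 (by omega) (by omega))
  · rw [show PolyhedralComplex3.sideLength k m false = k + 1 - m by
      simp [PolyhedralComplex3.sideLength], sum_range_eq_add_sum_Icc_reverse _ (by omega) hmk,
      PolyhedralComplex3.sideChain_zero, TensorProduct.zero_tmul, zero_add]
    · refine Finset.sum_congr rfl fun j hj => ?_
      obtain ⟨h2, hjk⟩ := Finset.mem_Icc.1 hj
      rw [PolyhedralComplex3.sideChain_false k e _ (by omega), hlam j]
      have hr := PolyhedralComplex3.sideReversed_false k v (fun x => ν x.1) (show j < k by omega)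
      have he : PolyhedralComplex3.sideEdge k e false (k - j) = e j := by
        simp only [PolyhedralComplex3.sideEdge, Bool.false_eq_true, if_false]
        congr 1
        omega
      rw [he]
      by_cases h : ν (v j).1 < ν (v (j + 1)).1
      · rw [if_pos h, if_pos (hr.2 h), add_zero]
      · rw [if_neg h, if_neg fun h' => h (hr.1 h'), show (1 + 1 : ZMod 2) = 0 from rfl]
    · rw [PolyhedralComplex3.sideReversed_false_zero]
      exact not_lt.2 (hmin k (by omega) le_rfl)
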